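/- Corollary 3 (Monotonicity with unbounded domain). Let $\mathcal{X}=[a,\infty)$, $M>0$, $\gamma\in(0,1)$, and let $g_0$ be a non-increasing, positive, finite probability density on $\mathcal{X}$. Let $\mathcal{F}=\{f:\ 0\le f(x)\le (Mg_0(x))^{1/(1-\gamma)}\ \forall x\in\mathcal{X},\ f \text{ is non-increasing on }\mathcal{X}\}$ and $\mathcal{L}=\{f/g_0: f\in\mathcal{F}\}$. Let $0\le m\le l$, $\mu_1,\dots,\mu_l\in\mathbb{R}$ and $\phi_0,\dots,\phi_l:\mathcal{X}\to\mathbb{R}$ with $\mathbb{E}_{g_0}|\phi_j(X)|^{2+\delta}<\infty$, $j=0,\dots,l$, for some $\delta>0$. (Taking one $\phi_j\equiv 1$ with $\mu_j=1$ as an equality constraint imposes total mass one.) Consider $$(\mathcal{P}):\quad \sup_{L\in\mathcal{L}}\ \mathbb{E}_{g_0}[\phi_0(X)L(X)]\quad\text{s.t. } \mathbb{E}_{g_0}[\phi_j(X)L(X)]\le\mu_j,\ 1\le j\le m,\quad \mathbb{E}_{g_0}[\phi_j(X)L(X)]=\mu_j,\ m<j\le l,$$ and, for $X_1,X_2,\dots$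 i.i.d. with density $g_0$, its sample average approximation $$(\mathcal{P}_n):\quad \sup_{L\in\mathcal{L}}\ \frac1n\sum_{i=1}^n\phi_0(X_i)L(X_i)\quad\text{s.t. } \frac1n\sum_{i=1}^n\phi_j(X_i)L(X_i)\le\mu_j,\ 1\le j\le m,\quad \frac1n\sum_{i=1}^n\phi_j(X_i)L(X_i)=\mu_j,\ m<j\le l,$$ with optimal values $val(\mathcal{P})$ and $val(\mathcal{P}_n)$ in $[-\infty,\infty]$ (the supremum over the empty set being $-\infty$). Assume that there is $L_0\in\mathcal{L}$ with $\mathbb{E}_{g_0}[\phi_j(X)L_0(X)]<\mu_j$ for $1\le j\le m$ and $\mathbb{E}_{g_0}[\phi_j(X)L_0(X)]=\mu_j$ for $m<j\le l$, and that $(\mu_{m+1},\dots,\mu_l)$ is an interior point of $\{(\mathbb{E}_{g_0}[\phi_{m+1}(X)L(X)],\dots,\mathbb{E}_{g_0}[\phi_l(X)L(X)]):L\in\mathcal{L}\}\subset\mathbb{R}^{l-m}$. Then: (1) For every realization of the sample, $(\mathcal{P}_n)$ is equivalent to the linear program $(\mathcal{P}'_n)$ in the variables $L(X_1),\dots,L(X_n)$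 (equal whenever the sample points coincide) that has the same objective and the same moment constraints as $(\mathcal{P}_n)$, with $L\in\mathcal{L}$ replaced by $$L(X_{(i+1)})g_0(X_{(i+1)})\le L(X_{(i)})g_0(X_{(i)}),\ 1\le i\le n-1,\qquad 0\le L(X_i)g_0(X_i)\le (Mg_0(X_i))^{1/(1-\gamma)},\ 1\le i\le n,$$ where $X_{(1)}\le\dots\le X_{(n)}$ are the order statistics. That is, the map $L\mapsto(L(X_1),\dots,L(X_n))$ sends $\mathcal{L}$ onto the set described by these discrete constraints and the feasible set of $(\mathcal{P}_n)$ onto that of $(\mathcal{P}'_n)$, and the two optimal values are equal. (2) $|val(\mathcal{P}_n)-val(\mathcal{P})|\to0$ outer almost surely, i.e. the minimal measurable majorants of $|val(\mathcal{P}_n)-val(\mathcal{P})|$ converge to $0$ almost surely. (3) $\sqrt n\,(val(\mathcal{P}_n)-val(\mathcal{P}))=O_{\mathbb{P}^*}(1)$, i.e. for every $\varepsilon>0$ there is $K>0$ with $\limsup_{n\to\infty}\mathbb{P}^*\big(|\sqrt n(val(\mathcal{P}_n)-val(\mathcal{P}))|\ge K\big)\le\varepsilon$, where $\mathbb{P}^*$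 is the outer probability. -/

import Mathlib

open MeasureTheory ProbabilityTheory Filter Topology
open scoped ENNReal

namespace IWSAA

/-- Lebesgue measure on the half-line `[a, ∞)`. -/
noncomputable def halfLineVolume (a : ℝ) : Measure (Set.Ici a) :=
  Measure.comap Subtype.val (volume : Measure ℝ)

/-- The measure with Lebesgue density `g` on the half-line `[a, ∞)`. -/
noncomputable def densityMeasure {a : ℝ} (g : Set.Ici a → ℝ) : Measure (Set.Ici a) :=
  (halfLineVolume a).withDensity (fun x => ENNReal.ofReal (g x))

/-- The class of non-increasing functions `f` on `[a, ∞)` with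
`0 ≤ f ≤ (M g₀)^{1/(1-γ)}` pointwise. -/
def shapeClass {a : ℝ} (M γ : ℝ) (g₀ : Set.Ici a → ℝ) : Set (Set.Ici a → ℝ) :=
  {f | (∀ x, 0 ≤ f x ∧ f x ≤ (M * g₀ x) ^ (1 / (1 - γ))) ∧ Antitone f}

section General

variable {S : Type*}

/-- The class of likelihood ratios `{f / g : f ∈ F}`. -/
def ratioClass (F : Set (S → ℝ)) (g : S → ℝ) : Set (S → ℝ) :=
  {L | ∃ f ∈ F, L = fun x => f x / g x}

/-- Feasible set of the moment problem `(P)` under the sampling law `Q`: ratios `L ∈ 𝓛` with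
`E_Q[φ_j L] ≤ μ_j` for `1 ≤ j ≤ m` and `E_Q[φ_j L] = μ_j` for `m + 1 ≤ j ≤ l`. -/
def feasible [MeasurableSpace S] (Q : Measure S) (m l : ℕ) (φ : ℕ → S → ℝ) (μ : ℕ → ℝ)
    (𝓛 : Set (S → ℝ)) : Set (S → ℝ) :=
  {L | L ∈ 𝓛 ∧
    (∀ j ∈ Set.Icc 1 m, ∫ x, φ j x * L x ∂Q ≤ μ j) ∧
    (∀ j ∈ Set.Ioc m l, ∫ x, φ j x * L x ∂Q = μ j)}

/-- Optimal value of `(P)`, an extended real (`⊥` if the problem is infeasible). -/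
noncomputable def val [MeasurableSpace S] (Q : Measure S) (m l : ℕ) (φ : ℕ → S → ℝ) (μ : ℕ → ℝ)
    (𝓛 : Set (S → ℝ)) : EReal :=
  ⨆ L ∈ feasible Q m l φ μ 𝓛, ((∫ x, φ 0 x * L x ∂Q : ℝ) : EReal)

/-- Feasible set of the sample average approximation `(P_n)` at the sample points `x`. -/
def saaFeasible {n : ℕ} (x : Fin n → S) (m l : ℕ) (φ : ℕ → S → ℝ) (μ : ℕ → ℝ)
    (𝓛 : Set (S → ℝ)) : Set (S → ℝ) :=
  {L | L ∈ 𝓛 ∧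
    (∀ j ∈ Set.Icc 1 m, (1 / (n : ℝ)) * ∑ i, φ j (x i) * L (x i) ≤ μ j) ∧
    (∀ j ∈ Set.Ioc m l, (1 / (n : ℝ)) * ∑ i, φ j (x i) * L (x i) = μ j)}

/-- Optimal value of `(P_n)`. -/
noncomputable def saaVal {n : ℕ} (x : Fin n → S) (m l : ℕ) (φ : ℕ → S → ℝ) (μ : ℕ → ℝ)
    (𝓛 : Set (S → ℝ)) : EReal :=
  ⨆ L ∈ saaFeasible x m l φ μ 𝓛, (((1 / (n : ℝ)) * ∑ i, φ 0 (x i) * L (x i) : ℝ) : EReal)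

/-- Feasible set of the finite-dimensional program `(P'_n)`, with decision variables
`y i = L (x i)` constrained to a set `D` (the discrete shape constraint). -/
def lpFeasible {n : ℕ} (x : Fin n → S) (m l : ℕ) (φ : ℕ → S → ℝ) (μ : ℕ → ℝ)
    (D : Set (Fin n → ℝ)) : Set (Fin n → ℝ) :=
  {y | y ∈ D ∧
    (∀ j ∈ Set.Icc 1 m, (1 / (n : ℝ)) * ∑ i, φ j (x i) * y i ≤ μ j) ∧
    (∀ j ∈ Set.Ioc m l, (1 / (n : ℝ)) * ∑ i, φ j (x i) * y i = μ j)}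

/-- Optimal value of `(P'_n)`. -/
noncomputable def lpVal {n : ℕ} (x : Fin n → S) (m l : ℕ) (φ : ℕ → S → ℝ) (μ : ℕ → ℝ)
    (D : Set (Fin n → ℝ)) : EReal :=
  ⨆ y ∈ lpFeasible x m l φ μ D, (((1 / (n : ℝ)) * ∑ i, φ 0 (x i) * y i : ℝ) : EReal)

/-- Slater condition for `(P)`: a point of `𝓛` that satisfies the inequalities strictly and the
equalities exactly, and `(μ_{m+1}, …, μ_l)` is interior to the set of attainable moment vectors
`(E_Q[φ_{m+1} L], …, E_Q[φ_l L])`, `L ∈ 𝓛`, in `ℝ^{l-m}`. -/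
def SlaterCondition [MeasurableSpace S] (Q : Measure S) (m l : ℕ) (φ : ℕ → S → ℝ) (μ : ℕ → ℝ)
    (𝓛 : Set (S → ℝ)) : Prop :=
  (∃ L₀ ∈ 𝓛, (∀ j ∈ Set.Icc 1 m, ∫ x, φ j x * L₀ x ∂Q < μ j) ∧
    (∀ j ∈ Set.Ioc m l, ∫ x, φ j x * L₀ x ∂Q = μ j)) ∧
  (fun j : Set.Ioc m l => μ (j : ℕ)) ∈
    interior {v : Set.Ioc m l → ℝ | ∃ L ∈ 𝓛, ∀ j : Set.Ioc m l, v j = ∫ x, φ j x * L x ∂Q}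

end General

/-- Discrete shape constraint at sample points `x : Fin n → [a, ∞)`, on `y i = L (x i)`; with
`σ = Tuple.sort x`, the points `x (σ 0) ≤ x (σ 1) ≤ ⋯` are the order statistics.
The first clause says that `y` is a function of the sample point; it is void if the sample points
are distinct. All clauses are linear in `y`. -/
def discreteShape {a : ℝ} (M γ : ℝ) (g₀ : Set.Ici a → ℝ) {n : ℕ} (x : Fin n → Set.Ici a) :
    Set (Fin n → ℝ) :=
  {y | (∀ i j, x i = x j → y i = y j) ∧
    (∀ (i : ℕ) (hi : i + 1 < n),
      y (Tuple.sort x ⟨i + 1, hi⟩) * g₀ (x (Tuple.sort x ⟨i + 1, hi⟩)) ≤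
        y (Tuple.sort x ⟨i, Nat.lt_of_succ_lt hi⟩) *
          g₀ (x (Tuple.sort x ⟨i, Nat.lt_of_succ_lt hi⟩))) ∧
    (∀ i, 0 ≤ y i * g₀ (x i) ∧ y i * g₀ (x i) ≤ (M * g₀ (x i)) ^ (1 / (1 - γ)))}

section Outer

variable {Ω : Type*} [MeasurableSpace Ω]

/-- `U` is a minimal measurable majorant `T^*` of the arbitrary map `T ≥ 0`. -/
def IsMinimalMajorant (P : Measure Ω) (T U : Ω → ℝ≥0∞) : Prop :=
  Measurable U ∧ (∀ ω, T ω ≤ U ω) ∧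
    ∀ V : Ω → ℝ≥0∞, Measurable V → (∀ᵐ ω ∂P, T ω ≤ V ω) → ∀ᵐ ω ∂P, U ω ≤ V ω

/-- Outer almost sure convergence `Y_n → c` (a.s.*) of arbitrary extended-real maps: the minimal
measurable majorants `|Y_n - c|^*` (unique up to null sets) tend to `0` almost surely. If `c` is
real then `|Y_n - c| = ∞` where `Y_n = ±∞`; if `c = ±∞` then `|Y_n - c| = ∞` and there is no
convergence. -/
def TendstoOuterAS (P : Measure Ω) (Y : ℕ → Ω → EReal) (c : EReal) : Prop :=
  ∃ U : ℕ → Ω → ℝ≥0∞,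
    (∀ n, IsMinimalMajorant P (fun ω => (Y n ω - c).abs) (U n)) ∧
    ∀ᵐ ω ∂P, Tendsto (fun n => U n ω) atTop (𝓝 0)

/-- `Z_n = O_{P^*}(1)`: for every `ε > 0` there is `K > 0` with
`limsup P^*(|Z_n| ≥ K) ≤ ε`. On an arbitrary set, a Mathlib measure takes the infimum over
measurable supersets, that is, the value of the outer probability `P^*`. -/
def BoundedInOuterProb (P : Measure Ω) (Z : ℕ → Ω → EReal) : Prop :=
  ∀ ε : ℝ, 0 < ε → ∃ K : ℝ, 0 < K ∧
    limsup (fun n => P {ω | ENNReal.ofReal K ≤ (Z n ω).abs}) atTop ≤ ENNReal.ofReal ε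

end Outer

end IWSAA

open IWSAA

/-! Two facts carry both limit statements.

First, under the Slater condition the optimal value is locally Lipschitz in the moment functionals:
if they all move by at most Δ, uniformly on the convex class `𝓛`, and Δ is small, then the value
moves by at most a constant times Δ (`exists_lipschitz_momentVal`). It remains to bound the
deviation of the sample means of `φ j * L` from their expectations, uniformly over `𝓛`.

Second, put p = 1/(1-γ) > 1 and write f = ∫₀ᵀ 1{t < f} dt. Each set {t < f} is an initial piece of
the half-line inside {t < (M g₀)^p}, where 1/g₀ ≤ M t^(-1/p). For fixed t only truncations of one
function remain. Symmetrization and a Doob-type maximal inequality bound the expected supremum of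
their unnormalised deviations by a constant times √n t^(-1/p). Since p > 1 this is integrable at 0,
so the uniform deviation of the means has a measurable bound of expectation O(1/√n)
(`enorm_deviation_le_shapeDeviation`, `exists_lintegral_shapeDeviation_le`).

Markov's inequality then gives the rate. For consistency, the expected bounds are summable along the
sample sizes k⁴, and the strong law for an integrable envelope fills the gaps. Optimal values need
not be measurable, so they are only ever compared with measurable bounds.

The reduction to a linear program is separate: admissible values at the sample points extend to a
step function of the class. -/

namespace IWSAA

/-! ### Stability of the value of a convex moment problem -/

/-- The affine span of `C` is closed in finite dimension, so it contains `closure C` and is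
everything; hence `C` has an interior point y. Prolonging the segment from y through x slightly
stays in `closure C`, so x lies strictly between an interior point and a point of the closure. -/
theorem interior_closure_subset_of_convex {E : Type*} [NormedAddCommGroup E] [NormedSpace ℝ E]
    [FiniteDimensional ℝ E] {C : Set E} (hC : Convex ℝ C) :
    interior (closure C) ⊆ interior C := by
  intro x hx
  have hne : (interior C).Nonempty := by
    rw [hC.interior_nonempty_iff_affineSpan_eq_top]
    have h1 : (affineSpan ℝ (closure C)) = ⊤ :=
      (hC.closure.interior_nonempty_iff_affineSpan_eq_top).1 ⟨x, hx⟩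
    rw [eq_top_iff, ← h1, affineSpan_le]
    exact closure_minimal (subset_affineSpan ℝ C)
      (AffineSubspace.closed_of_finiteDimensional _)
  obtain ⟨y, hy⟩ := hne
  have hcont : Tendsto (fun ε : ℝ => x + ε • (x - y)) (𝓝[>] 0) (𝓝 x) := by
    have : Continuous (fun ε : ℝ => x + ε • (x - y)) := by fun_prop
    simpa using (this.tendsto 0).mono_left nhdsWithin_le_nhds
  obtain ⟨ε, hε, hpos⟩ :=
    ((hcont.eventually (isOpen_interior.mem_nhds hx)).and self_mem_nhdsWithin).exists
  have hpos' : (0 : ℝ) < ε := hpos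
  refine hC.openSegment_interior_closure_subset_interior hy (interior_subset hε) ?_
  have h1 : (1 + ε) ≠ 0 := by positivity
  refine ⟨ε / (1 + ε), 1 / (1 + ε), by positivity, by positivity, by field_simp; ring, ?_⟩
  rw [smul_add, smul_smul, smul_sub]
  have e1 : (1 / (1 + ε)) • x + ((1 / (1 + ε)) * ε) • x = x := by
    rw [← add_smul]
    have : 1 / (1 + ε) + 1 / (1 + ε) * ε = 1 := by field_simp
    rw [this, one_smul]
  have e2 : (1 / (1 + ε)) * ε = ε / (1 + ε) := by ring
  rw [e2] at e1 ⊢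
  calc _ = (1 / (1 + ε)) • x + (ε / (1 + ε)) • x := by abel
    _ = x := e1

section Stability

variable {V : Type*} [AddCommGroup V] [Module ℝ V]

/-- The functionals `Θ j`, `j ≤ l`, respect convex combinations in `𝓛`. -/
def AffineOn (l : ℕ) (𝓛 : Set V) (Θ : ℕ → V → ℝ) : Prop :=
  ∀ j ≤ l, ∀ x ∈ 𝓛, ∀ y ∈ 𝓛, ∀ s t : ℝ, 0 ≤ s → 0 ≤ t → s + t = 1 →
    Θ j (s • x + t • y) = s * Θ j x + t * Θ j y

/-- The points of `𝓛` satisfying the moment constraints. -/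
def momentSet (m l : ℕ) (Θ : ℕ → V → ℝ) (μ : ℕ → ℝ) (𝓛 : Set V) : Set V :=
  {x | x ∈ 𝓛 ∧ (∀ j ∈ Set.Icc 1 m, Θ j x ≤ μ j) ∧ (∀ j ∈ Set.Ioc m l, Θ j x = μ j)}

/-- The value of the abstract moment problem. -/
noncomputable def momentVal (m l : ℕ) (Θ : ℕ → V → ℝ) (μ : ℕ → ℝ) (𝓛 : Set V) : EReal :=
  ⨆ x ∈ momentSet m l Θ μ 𝓛, ((Θ 0 x : ℝ) : EReal)

/-- Quantitative Slater condition with margin `ρ`. -/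
def SlaterMargin (m l : ℕ) (Θ : ℕ → V → ℝ) (μ : ℕ → ℝ) (𝓛 : Set V) (ρ : ℝ) : Prop :=
  ∀ w : Set.Ioc m l → ℝ, (∀ j, |w j| ≤ ρ) → ∃ x ∈ 𝓛, (∀ j ∈ Set.Icc 1 m, Θ j x ≤ μ j - ρ) ∧
    ∀ j : Set.Ioc m l, Θ j x = μ j + w j

/-- A little weight κ on a point that realises the equality levels μ + w/κ shifts the equality
moments of the Slater point by exactly w, and a small κ preserves half of its slack s. -/
theorem exists_slaterMargin {m l : ℕ} (hml : m ≤ l) {Θ : ℕ → V → ℝ} {μ : ℕ → ℝ} {𝓛 : Set V}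
    (h𝓛 : Convex ℝ 𝓛) (hΘ : AffineOn l 𝓛 Θ) {C : ℝ} (hC : ∀ j ≤ l, ∀ x ∈ 𝓛, |Θ j x| ≤ C)
    (hS : (∃ x₀ ∈ 𝓛, (∀ j ∈ Set.Icc 1 m, Θ j x₀ < μ j) ∧ (∀ j ∈ Set.Ioc m l, Θ j x₀ = μ j)) ∧
      (fun j : Set.Ioc m l => μ (j : ℕ)) ∈
        interior {v : Set.Ioc m l → ℝ | ∃ x ∈ 𝓛, ∀ j : Set.Ioc m l, v j = Θ j x}) :
    ∃ ρ > 0, SlaterMargin m l Θ μ 𝓛 ρ := by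
  obtain ⟨⟨x₀, hx₀, hineq, heq⟩, hint⟩ := hS
  obtain ⟨r, hr, hball⟩ := Metric.nhds_basis_closedBall.mem_iff.1 (mem_interior_iff_mem_nhds.1 hint)
  obtain ⟨s, hs, hslack⟩ : ∃ s > 0, ∀ j ∈ Set.Icc 1 m, Θ j x₀ ≤ μ j - s := by
    have : ∀ᶠ s : ℝ in 𝓝[>] 0, ∀ j ∈ Set.Icc 1 m, Θ j x₀ ≤ μ j - s := by
      rw [eventually_all_finite (Set.finite_Icc 1 m)]
      intro j hj
      have h1 : ∀ᶠ s : ℝ in 𝓝 0, s < μ j - Θ j x₀ :=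
        eventually_lt_nhds (by linarith [hineq j hj])
      filter_upwards [h1.filter_mono nhdsWithin_le_nhds] with s hs
      linarith
    obtain ⟨s, h1, h2⟩ := (this.and self_mem_nhdsWithin).exists
    exact ⟨s, h2, h1⟩
  have hC0 : 0 ≤ C := (abs_nonneg _).trans (hC 0 (Nat.zero_le _) x₀ hx₀)
  -- `D` bounds every C - μ j + s, so κ = s/(2D) costs at most s/2 of slack in each inequality.
  set D := C + ∑ j ∈ Finset.Icc 1 m, |μ j| + s with hD
  have hsum : 0 ≤ ∑ j ∈ Finset.Icc 1 m, |μ j| := Finset.sum_nonneg fun _ _ => abs_nonneg _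
  have hDpos : 0 < D := by positivity
  set κ := s / (2 * D) with hκ
  have hκpos : 0 < κ := by positivity
  have hκ1 : κ ≤ 1 := by
    rw [hκ, div_le_one (by positivity)]; linarith
  refine ⟨min (s / 2) (κ * r), by positivity, ?_⟩
  intro w hw
  have hv : (fun j : Set.Ioc m l => μ j + w j / κ) ∈ Metric.closedBall
      (fun j : Set.Ioc m l => μ (j : ℕ)) r := by
    rw [Metric.mem_closedBall, dist_pi_le_iff hr.le]
    intro j
    rw [Real.dist_eq, add_sub_cancel_left, abs_div, abs_of_pos hκpos, div_le_iff₀ hκpos]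
    exact (hw j).trans ((min_le_right _ _).trans_eq (mul_comm _ _))
  obtain ⟨y, hy, hyv⟩ := hball hv
  refine ⟨(1 - κ) • x₀ + κ • y, h𝓛 hx₀ hy (by linarith) hκpos.le (by ring), ?_, ?_⟩
  · intro j hj
    rw [hΘ j (hj.2.trans hml) x₀ hx₀ y hy _ _ (by linarith) hκpos.le (by ring)]
    have h1 := hslack j hj
    have h2 := (abs_le.1 (hC j (hj.2.trans hml) y hy)).2
    have h3 : |μ j| ≤ ∑ j ∈ Finset.Icc 1 m, |μ j| :=
      Finset.single_le_sum (f := fun j => |μ j|) (fun _ _ => abs_nonneg _)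
        (Finset.mem_Icc.2 hj)
    have h4 : κ * D = s / 2 := by rw [hκ]; field_simp
    have h5 : C - μ j + s ≤ D := by linarith [neg_abs_le (μ j)]
    have h6 := mul_le_mul_of_nonneg_left h5 hκpos.le
    have h7 := mul_le_mul_of_nonneg_left h1 (sub_nonneg.2 hκ1)
    have h8 := mul_le_mul_of_nonneg_left h2 hκpos.le
    have h9 := min_le_left (s / 2) (κ * r)
    nlinarith
  · intro j
    rw [hΘ j j.2.2 x₀ hx₀ y hy _ _ (by linarith) hκpos.le (by ring), heq j j.2, ← hyv j]
    field_simp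
    ring

/-- A margin survives perturbation by convexity, without any continuity of a solution map: the
perturbed equality vectors form a convex set, separation shows that its closure contains a ball, and
in finite dimension the closure can then be dropped. -/
theorem SlaterMargin.of_near {m l : ℕ} (hml : m ≤ l) {Θ Θ' : ℕ → V → ℝ} {μ : ℕ → ℝ} {𝓛 : Set V}
    {ρ : ℝ} (hρ : 0 < ρ) (h : SlaterMargin m l Θ μ 𝓛 ρ) (h𝓛 : Convex ℝ 𝓛) (hΘ : AffineOn l 𝓛 Θ)
    (hΘ' : AffineOn l 𝓛 Θ') (hnear : ∀ j ≤ l, ∀ x ∈ 𝓛, |Θ' j x - Θ j x| ≤ ρ / 2) :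
    SlaterMargin m l Θ' μ 𝓛 (ρ / 4) := by
  classical
  set C : Set (Set.Ioc m l → ℝ) :=
    {v | ∃ x ∈ 𝓛, (∀ j ∈ Set.Icc 1 m, Θ j x ≤ μ j - ρ) ∧ ∀ j : Set.Ioc m l, Θ' j x = v j} with hCdef
  have hconv : Convex ℝ C := by
    rintro v ⟨x, hx, hx1, hx2⟩ v' ⟨y, hy, hy1, hy2⟩ s t hs ht hst
    refine ⟨s • x + t • y, h𝓛 hx hy hs ht hst, ?_, ?_⟩
    · intro j hj
      rw [hΘ j (hj.2.trans hml) x hx y hy s t hs ht hst]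
      have h1 := mul_le_mul_of_nonneg_left (hx1 j hj) hs
      have h2 := mul_le_mul_of_nonneg_left (hy1 j hj) ht
      have h3 : s * (μ j - ρ) + t * (μ j - ρ) = μ j - ρ := by rw [← add_mul, hst, one_mul]
      linarith
    · intro j
      rw [hΘ' j j.2.2 x hx y hy s t hs ht hst, hx2 j, hy2 j]
      simp
  have hball : Metric.ball (fun j : Set.Ioc m l => μ (j : ℕ)) (ρ / 2) ⊆ closure C := by
    intro w hw
    by_contra hnot
    obtain ⟨f, u, hf1, hf2⟩ := geometric_hahn_banach_closed_point hconv.closure isClosed_closure hnot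
    set c : Set.Ioc m l → ℝ := fun j => f (Pi.single j 1) with hc
    have hfc : ∀ v, f v = ∑ j, v j * c j := fun v => by
      conv_lhs => rw [← Finset.univ_sum_single v]
      rw [map_sum]
      refine Finset.sum_congr rfl fun j _ => ?_
      rw [hc, ← smul_eq_mul, ← map_smul, ← Pi.single_smul, smul_eq_mul, mul_one]
    -- This corner of the cube maximises the separating functional, exceeding its value at μ by ρ
    -- Σ|c j|. Replacing Θ by Θ' loses at most half of that, and w gains at most half of it over μ,
    -- so w cannot be strictly separated.
    obtain ⟨x, hx, hx1, hx2⟩ := h (fun j => ρ * (SignType.sign (c j) : ℝ)) (fun j => by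
      rw [abs_mul, abs_of_pos hρ]
      have : |((SignType.sign (c j) : SignType) : ℝ)| ≤ 1 := by
        cases SignType.sign (c j) <;> simp
      nlinarith)
    have h1 : f (fun j : Set.Ioc m l => Θ' j x) < f w :=
      (hf1 _ (subset_closure ⟨x, hx, hx1, fun _ => rfl⟩)).trans hf2
    rw [hfc, hfc] at h1
    refine absurd h1 (not_lt.2 (Finset.sum_le_sum fun j _ => ?_))
    have hwj : |w j - μ j| ≤ ρ / 2 := by
      rw [← Real.dist_eq]
      exact (dist_le_pi_dist w _ j).trans (Metric.mem_ball.1 hw).le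
    have hxj := hnear j j.2.2 x hx
    rw [hx2 j] at hxj
    have hsgn : ((SignType.sign (c j) : SignType) : ℝ) * c j = |c j| := sign_mul_self _
    have e1 : |(Θ' j x - (μ j + ρ * (SignType.sign (c j) : ℝ))) * c j| ≤ ρ / 2 * |c j| := by
      rw [abs_mul]; gcongr
    have e2 : |(w j - μ j) * c j| ≤ ρ / 2 * |c j| := by
      rw [abs_mul]; gcongr
    have e3 := (abs_le.1 e1).1
    have e4 := (abs_le.1 e2).2
    have e5 : ρ * (SignType.sign (c j) : ℝ) * c j = ρ * |c j| := by rw [mul_assoc, hsgn]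
    nlinarith
  have hint : Metric.ball (fun j : Set.Ioc m l => μ (j : ℕ)) (ρ / 2) ⊆ C :=
    ((Metric.isOpen_ball.subset_interior_iff.2 hball).trans
      (interior_closure_subset_of_convex hconv)).trans interior_subset
  intro w hw
  have hmem : (fun j : Set.Ioc m l => μ j + w j) ∈ Metric.ball
      (fun j : Set.Ioc m l => μ (j : ℕ)) (ρ / 2) := by
    rw [Metric.mem_ball, dist_pi_lt_iff (by positivity)]
    intro j
    rw [Real.dist_eq, add_sub_cancel_left]
    linarith [hw j]
  obtain ⟨x, hx, hx1, hx2⟩ := hint hmem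
  refine ⟨x, hx, fun j hj => ?_, hx2⟩
  have := (abs_le.1 (hnear j (hj.2.trans hml) x hx)).2
  linarith [hx1 j hj]

/-- A point violating the constraints by Δ is mixed with a margin point whose equality errors are
opposite and larger by the factor ρ/Δ. The weights ρ/(Δ+ρ) and Δ/(Δ+ρ) cancel these errors exactly,
and the small second weight limits the loss in the objective. -/
theorem SlaterMargin.exists_repair {m l : ℕ} (hml : m ≤ l) {Θ : ℕ → V → ℝ} {μ : ℕ → ℝ} {𝓛 : Set V}
    {ρ : ℝ} (hρ : 0 < ρ) (h : SlaterMargin m l Θ μ 𝓛 ρ) (h𝓛 : Convex ℝ 𝓛) (hΘ : AffineOn l 𝓛 Θ)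
    {C : ℝ} (hC : ∀ x ∈ 𝓛, |Θ 0 x| ≤ C) {Δ : ℝ} (hΔ : 0 ≤ Δ) {x : V} (hx : x ∈ 𝓛)
    (hineq : ∀ j ∈ Set.Icc 1 m, Θ j x ≤ μ j + Δ) (heq : ∀ j ∈ Set.Ioc m l, |Θ j x - μ j| ≤ Δ) :
    ∃ x' ∈ momentSet m l Θ μ 𝓛, Θ 0 x - 2 * C / ρ * Δ ≤ Θ 0 x' := by
  have hC0 : 0 ≤ C := (abs_nonneg _).trans (hC x hx)
  obtain ⟨y, hy, hy1, hy2⟩ := h (fun j => -(ρ / Δ * (Θ j x - μ j))) (fun j => by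
    rw [abs_neg, abs_mul, abs_of_nonneg (by positivity : 0 ≤ ρ / Δ)]
    -- For Δ = 0 the convention ρ / 0 = 0 makes the requested shift zero, and the second point gets
    -- weight zero.
    rcases hΔ.eq_or_lt with h0 | h0
    · rw [← h0]; simpa using hρ.le
    · rw [div_mul_eq_mul_div, div_le_iff₀ h0]
      exact mul_le_mul_of_nonneg_left (heq j j.2) hρ.le)
  have hsum : 0 < Δ + ρ := by positivity
  have h1 : 0 ≤ ρ / (Δ + ρ) := by positivity
  have h2 : 0 ≤ Δ / (Δ + ρ) := by positivity
  have h3 : ρ / (Δ + ρ) + Δ / (Δ + ρ) = 1 := by field_simp; ring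
  refine ⟨(ρ / (Δ + ρ)) • x + (Δ / (Δ + ρ)) • y, ⟨h𝓛 hx hy h1 h2 h3, ?_, ?_⟩, ?_⟩
  · intro j hj
    rw [hΘ j (hj.2.trans hml) x hx y hy _ _ h1 h2 h3]
    have e1 := mul_le_mul_of_nonneg_left (hineq j hj) h1
    have e2 := mul_le_mul_of_nonneg_left (hy1 j hj) h2
    have e3 : ρ / (Δ + ρ) * (μ j + Δ) + Δ / (Δ + ρ) * (μ j - ρ) = μ j := by
      field_simp; ring
    linarith
  · intro j hj
    rw [hΘ j hj.2 x hx y hy _ _ h1 h2 h3, hy2 ⟨j, hj⟩]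
    rcases hΔ.eq_or_lt with h0 | h0
    · have := heq j hj
      rw [← h0] at this ⊢
      have h4 : Θ j x = μ j := by
        have := abs_nonpos_iff.1 this
        linarith
      rw [h4]; field_simp; ring
    · simp only
      field_simp
      ring
  · rw [hΘ 0 (Nat.zero_le _) x hx y hy _ _ h1 h2 h3]
    have e1 := (abs_le.1 (hC x hx)).2
    have e2 := (abs_le.1 (hC y hy)).1
    have e3 : Δ / (Δ + ρ) ≤ Δ / ρ := by gcongr; linarith
    have e4 : ρ / (Δ + ρ) = 1 - Δ / (Δ + ρ) := by linarith
    rw [e4]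
    have e5 : Δ / (Δ + ρ) * (Θ 0 x - Θ 0 y) ≤ Δ / (Δ + ρ) * (2 * C) :=
      mul_le_mul_of_nonneg_left (by linarith) h2
    have e6 : Δ / (Δ + ρ) * (2 * C) ≤ Δ / ρ * (2 * C) :=
      mul_le_mul_of_nonneg_right e3 (by positivity)
    have e7 : 2 * C / ρ * Δ = Δ / ρ * (2 * C) := by ring
    rw [e7]
    linarith

/-- A point feasible for one problem is Δ-feasible for the other, so repairing it in each direction
compares the two values. The perturbed problem has its own margin, by `SlaterMargin.of_near`. -/
theorem exists_lipschitz_momentVal {m l : ℕ} (hml : m ≤ l) {Θ : ℕ → V → ℝ} {μ : ℕ → ℝ} {𝓛 : Set V}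
    (h𝓛 : Convex ℝ 𝓛) (hΘ : AffineOn l 𝓛 Θ) {C : ℝ} (hC : ∀ j ≤ l, ∀ x ∈ 𝓛, |Θ j x| ≤ C)
    (hS : (∃ x₀ ∈ 𝓛, (∀ j ∈ Set.Icc 1 m, Θ j x₀ < μ j) ∧ (∀ j ∈ Set.Ioc m l, Θ j x₀ = μ j)) ∧
      (fun j : Set.Ioc m l => μ (j : ℕ)) ∈
        interior {v : Set.Ioc m l → ℝ | ∃ x ∈ 𝓛, ∀ j : Set.Ioc m l, v j = Θ j x}) :
    ∃ c : ℝ, momentVal m l Θ μ 𝓛 = c ∧ ∃ η > 0, ∃ K > 0, ∀ Θ' : ℕ → V → ℝ, AffineOn l 𝓛 Θ' →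
      ∀ Δ, 0 ≤ Δ → Δ ≤ η → (∀ j ≤ l, ∀ x ∈ 𝓛, |Θ' j x - Θ j x| ≤ Δ) →
        ∃ c' : ℝ, momentVal m l Θ' μ 𝓛 = c' ∧ |c' - c| ≤ K * Δ := by
  obtain ⟨ρ, hρ, hmargin⟩ := exists_slaterMargin hml h𝓛 hΘ hC hS
  have key : ∀ (Θ : ℕ → V → ℝ) (C : ℝ), (∀ x ∈ 𝓛, |Θ 0 x| ≤ C) →
      (momentSet m l Θ μ 𝓛).Nonempty → ∃ c : ℝ, momentVal m l Θ μ 𝓛 = c := by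
    rintro Θ C hC ⟨x, hx⟩
    have h1 : momentVal m l Θ μ 𝓛 ≤ (C : EReal) :=
      iSup₂_le fun y hy => EReal.coe_le_coe_iff.2 ((le_abs_self _).trans (hC y hy.1))
    have h2 : ((Θ 0 x : ℝ) : EReal) ≤ momentVal m l Θ μ 𝓛 :=
      le_iSup₂ (f := fun y (_ : y ∈ momentSet m l Θ μ 𝓛) => ((Θ 0 y : ℝ) : EReal)) x hx
    refine ⟨(momentVal m l Θ μ 𝓛).toReal, (EReal.coe_toReal ?_ ?_).symm⟩
    · exact (h1.trans_lt (EReal.coe_lt_top _)).ne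
    · exact ((EReal.bot_lt_coe _).trans_le h2).ne'
  have cmp : ∀ (Θ Θ' : ℕ → V → ℝ) (c c' e : ℝ), momentVal m l Θ μ 𝓛 = c →
      momentVal m l Θ' μ 𝓛 = c' → (∀ x ∈ momentSet m l Θ μ 𝓛,
        ∃ x' ∈ momentSet m l Θ' μ 𝓛, Θ 0 x - e ≤ Θ' 0 x') → c ≤ c' + e := by
    intro Θ Θ' c c' e hc hc' hx
    have : momentVal m l Θ μ 𝓛 ≤ ((c' + e : ℝ) : EReal) := by
      refine iSup₂_le fun x hxm => ?_
      obtain ⟨x', hx', hle⟩ := hx x hxm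
      have h2 : ((Θ' 0 x' : ℝ) : EReal) ≤ momentVal m l Θ' μ 𝓛 :=
        le_iSup₂ (f := fun y (_ : y ∈ momentSet m l Θ' μ 𝓛) => ((Θ' 0 y : ℝ) : EReal)) x' hx'
      rw [hc', EReal.coe_le_coe_iff] at h2
      rw [EReal.coe_le_coe_iff]
      linarith
    rwa [hc, EReal.coe_le_coe_iff] at this
  obtain ⟨x₀, hx₀, hx₀1, hx₀2⟩ := hS.1
  have hC0 : 0 ≤ C := (abs_nonneg _).trans (hC 0 (Nat.zero_le _) x₀ hx₀)
  obtain ⟨c, hc⟩ := key Θ C (hC 0 (Nat.zero_le _)) ⟨x₀, hx₀, fun j hj => (hx₀1 j hj).le, hx₀2⟩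
  -- The constant belongs to repair in the perturbed problem, with margin ρ/4 and objective bound C
  -- + ρ/2; it dominates the one for the reverse direction. The extra 1 pays for changing the
  -- objective itself.
  refine ⟨c, hc, ρ / 2, by positivity, 1 + 2 * (C + ρ / 2) / (ρ / 4), by positivity, ?_⟩
  intro Θ' hΘ' Δ hΔ hΔη hnear
  have hmargin' : SlaterMargin m l Θ' μ 𝓛 (ρ / 4) :=
    hmargin.of_near hml hρ h𝓛 hΘ hΘ' fun j hj x hx => (hnear j hj x hx).trans hΔη
  have hC' : ∀ x ∈ 𝓛, |Θ' 0 x| ≤ C + ρ / 2 := fun x hx => by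
    have h1 := hnear 0 (Nat.zero_le _) x hx
    have h2 := hC 0 (Nat.zero_le _) x hx
    have h3 := abs_add_le (Θ' 0 x - Θ 0 x) (Θ 0 x)
    rw [sub_add_cancel] at h3
    linarith
  obtain ⟨c', hc'⟩ := key Θ' _ hC' (by
    obtain ⟨x, hx, hx1, hx2⟩ := hmargin' 0 (fun j => by simpa using by positivity)
    exact ⟨x, hx, fun j hj => (hx1 j hj).trans (by linarith), fun j hj => by simpa using hx2 ⟨j, hj⟩⟩)
  refine ⟨c', hc', ?_⟩
  have up := cmp Θ Θ' c c' ((1 + 2 * (C + ρ / 2) / (ρ / 4)) * Δ) hc hc' (by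
    rintro x ⟨hx, hx1, hx2⟩
    obtain ⟨x', hx', hle⟩ := hmargin'.exists_repair hml (by positivity) h𝓛 hΘ' hC' hΔ hx
      (fun j hj => by
        have := (abs_le.1 (hnear j (hj.2.trans hml) x hx)).2
        linarith [hx1 j hj])
      (fun j hj => by rw [← hx2 j hj]; exact hnear j hj.2 x hx)
    refine ⟨x', hx', ?_⟩
    have := (abs_le.1 (hnear 0 (Nat.zero_le _) x hx)).1
    linarith)
  have down := cmp Θ' Θ c' c ((1 + 2 * C / ρ) * Δ) hc' hc (by
    rintro x ⟨hx, hx1, hx2⟩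
    obtain ⟨x', hx', hle⟩ := hmargin.exists_repair hml hρ h𝓛 hΘ (hC 0 (Nat.zero_le _)) hΔ hx
      (fun j hj => by
        have := (abs_le.1 (hnear j (hj.2.trans hml) x hx)).1
        linarith [hx1 j hj])
      (fun j hj => by rw [← hx2 j hj, abs_sub_comm]; exact hnear j hj.2 x hx)
    refine ⟨x', hx', ?_⟩
    have := (abs_le.1 (hnear 0 (Nat.zero_le _) x hx)).2
    linarith)
  have hK : 2 * C / ρ ≤ 2 * (C + ρ / 2) / (ρ / 4) := by
    gcongr <;> linarith
  have hK' := mul_le_mul_of_nonneg_right hK hΔ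
  rw [abs_le]
  constructor <;> linarith

end Stability

/-! ### Finite-dimensional reduction -/

theorem image_ratioClass_eq_discreteShape {a M γ : ℝ} (hM : 0 < M) (hγ : γ < 1)
    {g₀ : Set.Ici a → ℝ} (hanti : Antitone g₀) (hpos : ∀ x, 0 < g₀ x) {n : ℕ}
    (x : Fin n → Set.Ici a) :
    (fun (L : Set.Ici a → ℝ) (i : Fin n) => L (x i)) '' ratioClass (shapeClass M γ g₀) g₀ =
      discreteShape M γ g₀ x := by
  have hp : 0 ≤ 1 / (1 - γ) := by
    have : 0 < 1 - γ := by linarith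
    positivity
  have hsort : Monotone (x ∘ Tuple.sort x) := Tuple.monotone_sort x
  ext y
  constructor
  · rintro ⟨_, ⟨f, ⟨hf, hfa⟩, rfl⟩, rfl⟩
    have hmul : ∀ z, f z / g₀ z * g₀ z = f z := fun z => div_mul_cancel₀ _ (hpos z).ne'
    refine ⟨fun i j hij => ?_, fun i hi => ?_, fun i => ?_⟩
    · simp only [hij]
    · simp only [hmul]
      exact hfa (hsort (Fin.mk_le_mk.2 (Nat.le_succ i)))
    · simp only [hmul]
      exact hf _
  · rintro ⟨hfun, hmono, hbd⟩
    have hsorted : Antitone fun i : Fin n => y (Tuple.sort x i) * g₀ (x (Tuple.sort x i)) := by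
      rcases n with _ | n
      · exact fun i => i.elim0
      · exact Fin.antitone_iff_succ_le.2 fun i => hmono i (by omega)
    have hanti' : ∀ i j, x i ≤ x j → y j * g₀ (x j) ≤ y i * g₀ (x i) := by
      intro i j hij
      rcases hij.eq_or_lt with h | h
      · rw [hfun i j h, h]
      · have := hsorted (a := (Tuple.sort x).symm i) (b := (Tuple.sort x).symm j) (by
          by_contra hlt
          have := hsort (not_le.1 hlt).le
          simp only [Function.comp, Equiv.apply_symm_apply] at this
          exact absurd h (not_lt.2 this))
        simpa using this
    -- The least non-negative, non-increasing extension: the largest prescribed value at a sample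
    -- point to the right of z. Taking the supremum in `NNReal` makes it 0 beyond the last point.
    -- The upper bound is inherited because g₀ decreases from z to those points.
    set f : Set.Ici a → ℝ := fun z =>
      ((Finset.univ.filter fun i => z ≤ x i).sup fun i => (y i * g₀ (x i)).toNNReal : NNReal)
      with hf
    have hfx : ∀ i, f (x i) = y i * g₀ (x i) := by
      intro i
      rw [hf]
      simp only
      rw [← Real.coe_toNNReal _ (hbd i).1]
      congr 1
      refine le_antisymm (Finset.sup_le fun j hj => ?_) ?_
      · exact Real.toNNReal_le_toNNReal (hanti' i j (Finset.mem_filter.1 hj).2)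
      · exact Finset.le_sup (f := fun i => (y i * g₀ (x i)).toNNReal) (by simp)
    refine ⟨fun z => f z / g₀ z, ⟨f, ⟨fun z => ⟨NNReal.coe_nonneg _, ?_⟩, ?_⟩, rfl⟩, ?_⟩
    · have h0 : 0 ≤ (M * g₀ z) ^ (1 / (1 - γ)) :=
        Real.rpow_nonneg (mul_pos hM (hpos z)).le _
      rw [← Real.coe_toNNReal _ h0]
      refine NNReal.coe_le_coe.2 (Finset.sup_le fun j hj => Real.toNNReal_le_toNNReal ?_)
      refine (hbd j).2.trans (Real.rpow_le_rpow (mul_pos hM (hpos _)).le ?_ hp)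
      exact mul_le_mul_of_nonneg_left (hanti (Finset.mem_filter.1 hj).2) hM.le
    · intro z z' hz
      refine NNReal.coe_le_coe.2 (Finset.sup_mono ?_)
      intro j hj
      simp only [Finset.mem_filter, Finset.mem_univ, true_and] at hj ⊢
      exact hz.trans hj
    · funext i
      simp only [hfx]
      exact mul_div_cancel_right₀ _ (hpos _).ne'

theorem image_saaFeasible {S : Type*} {n : ℕ} (x : Fin n → S) (m l : ℕ) (φ : ℕ → S → ℝ)
    (μ : ℕ → ℝ) (𝓛 : Set (S → ℝ)) :
    (fun (L : S → ℝ) (i : Fin n) => L (x i)) '' saaFeasible x m l φ μ 𝓛 =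
      lpFeasible x m l φ μ ((fun (L : S → ℝ) (i : Fin n) => L (x i)) '' 𝓛) := by
  ext y
  constructor
  · rintro ⟨L, ⟨hL, h1, h2⟩, rfl⟩
    exact ⟨⟨L, hL, rfl⟩, h1, h2⟩
  · rintro ⟨⟨L, hL, rfl⟩, h1, h2⟩
    exact ⟨L, ⟨hL, h1, h2⟩, rfl⟩

theorem saaVal_eq_lpVal {S : Type*} {n : ℕ} (x : Fin n → S) (m l : ℕ) (φ : ℕ → S → ℝ)
    (μ : ℕ → ℝ) (𝓛 : Set (S → ℝ)) :
    saaVal x m l φ μ 𝓛 =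
      lpVal x m l φ μ ((fun (L : S → ℝ) (i : Fin n) => L (x i)) '' 𝓛) := by
  rw [lpVal, ← image_saaFeasible, iSup_image]
  rfl

/-! ### Minimal measurable majorants -/

/-- The majorant is assembled from measurable hulls of the rational superlevel sets of `T`. A hull
meets each measurable set in the same measure as the original set, so a measurable V ≥ T a.e. cannot
lie below q on more than a null part of the hull. -/
theorem exists_isMinimalMajorant {Ω : Type*} [MeasurableSpace Ω] (P : Measure Ω)
    [IsFiniteMeasure P] (T : Ω → ℝ≥0∞) : ∃ U, IsMinimalMajorant P T U := by
  set A : ℚ → Set Ω := fun q => toMeasurable P {ω | ENNReal.ofReal q < T ω} with hA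
  have hAm : ∀ q, MeasurableSet (A q) := fun q => measurableSet_toMeasurable _ _
  refine ⟨fun ω => ⨆ q : ℚ, (A q).indicator (fun _ => ENNReal.ofReal q) ω, ?_, ?_, ?_⟩
  · exact Measurable.iSup fun q => measurable_const.indicator (hAm q)
  · intro ω
    refine le_of_forall_lt fun c hc => ?_
    obtain ⟨q, hq0, hcq, hqT⟩ := ENNReal.lt_iff_exists_rat_btwn.1 hc
    have hmem : ω ∈ A q := subset_toMeasurable P _ hqT
    refine hcq.trans_le ?_
    refine le_trans ?_ (le_iSup _ q)
    rw [Set.indicator_of_mem hmem]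
    exact le_rfl
  · intro V hV hTV
    have hq : ∀ q : ℚ, ∀ᵐ ω ∂P, ω ∈ A q → ENNReal.ofReal q ≤ V ω := by
      intro q
      have hms : MeasurableSet {ω | V ω < ENNReal.ofReal q} :=
        measurableSet_lt hV measurable_const
      have h0 : P (A q ∩ {ω | V ω < ENNReal.ofReal q}) = 0 := by
        rw [hA, Measure.measure_toMeasurable_inter hms (measure_ne_top _ _)]
        refine measure_mono_null ?_ (ae_iff.1 hTV)
        rintro ω ⟨h1, h2⟩
        exact not_le.2 (lt_trans h2 h1)
      rw [ae_iff]
      refine measure_mono_null ?_ h0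
      intro ω hω
      simpa using hω
    filter_upwards [ae_all_iff.2 hq] with ω hω
    refine iSup_le fun q => ?_
    by_cases h : ω ∈ A q
    · rw [Set.indicator_of_mem h]; exact hω q h
    · rw [Set.indicator_of_notMem h]; exact zero_le

theorem tendstoOuterAS_of_le {Ω : Type*} [MeasurableSpace Ω] {P : Measure Ω} [IsFiniteMeasure P]
    {Y : ℕ → Ω → EReal} {c : EReal} {V : ℕ → Ω → ℝ≥0∞} (hV : ∀ n, Measurable (V n))
    (hle : ∀ n, ∀ᵐ ω ∂P, (Y n ω - c).abs ≤ V n ω)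
    (hlim : ∀ᵐ ω ∂P, Tendsto (fun n => V n ω) atTop (𝓝 0)) : TendstoOuterAS P Y c := by
  choose U hU using fun n => exists_isMinimalMajorant P fun ω => (Y n ω - c).abs
  refine ⟨U, hU, ?_⟩
  filter_upwards [hlim, ae_all_iff.2 fun n => (hU n).2.2 (V n) (hV n) (hle n)] with ω h1 h2
  exact tendsto_of_tendsto_of_tendsto_of_le_of_le tendsto_const_nhds h1 (fun _ => zero_le) h2

/-! ### A maximal inequality for random signs -/

/-- The signed sum of `a` over the indices of `s` with key below `q`; the sign is `+` on `B`. -/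
noncomputable def signedSum {ι : Type*} [DecidableEq ι] (k a : ι → ℝ) (s B : Finset ι) (q : ℝ) : ℝ :=
  ∑ i ∈ s with k i < q, if i ∈ B then a i else -a i

/-- Doob's L² inequality by a potential function. Revealing indices by increasing key makes the
truncated sums a random walk, with current position c and running maximum m; since `q` may depend on
the signs, the left side covers the maximum over time. The potential 2m² - 4mc + 4c² dominates m²,
and averaging over a step ±a adds exactly 4a². -/
theorem sum_sq_max_signedSum_le {ι : Type*} [DecidableEq ι] (k a : ι → ℝ) (s : Finset ι) :
    ∀ (c m : ℝ) (_ : 0 ≤ m) (_ : c ≤ m) (q : Finset ι → ℝ),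
      ∑ B ∈ s.powerset, (max m (c + signedSum k a s B (q B))) ^ 2 ≤
        2 ^ s.card * (2 * m ^ 2 - 4 * m * c + 4 * c ^ 2 + 4 * ∑ i ∈ s, a i ^ 2) := by
  induction s using Finset.induction_on_min_value k with
  | empty =>
    intro c m hm hc q
    simp only [Finset.powerset_empty, Finset.sum_singleton, signedSum, Finset.filter_empty,
      Finset.sum_empty, add_zero, max_eq_left hc, Finset.card_empty, pow_zero, one_mul, mul_zero]
    nlinarith [sq_nonneg (m - 2 * c)]
  | insert i s hi hmin ih =>
    intro c m hm hc q
    have step : ∀ (ε : ℝ) (T : Finset ι → Finset ι),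
        (∀ B ∈ s.powerset, (if i ∈ T B then a i else -a i) = ε ∧ ∀ j ∈ s, (j ∈ T B ↔ j ∈ B)) →
        ∑ B ∈ s.powerset, (max m (c + signedSum k a (insert i s) (T B) (q (T B)))) ^ 2 ≤
        2 ^ s.card * (2 * m ^ 2 - 4 * m * (c + ε) + 4 * (c + ε) ^ 2 + 4 * ∑ i ∈ s, a i ^ 2) := by
      intro ε T hT
      have h1 := ih (c + ε) (max m (c + ε)) (hm.trans (le_max_left _ _)) (le_max_right _ _)
        (fun B => q (T B))
      -- Updating the running maximum never raises the potential: the drop is 2(m - (c + ε))² when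
      -- the maximum moves.
      have h2 : 2 * (max m (c + ε)) ^ 2 - 4 * (max m (c + ε)) * (c + ε) + 4 * (c + ε) ^ 2 ≤
          2 * m ^ 2 - 4 * m * (c + ε) + 4 * (c + ε) ^ 2 := by
        rcases le_total m (c + ε) with h | h
        · rw [max_eq_right h]; nlinarith [sq_nonneg (m - (c + ε))]
        · rw [max_eq_left h]
      refine (Finset.sum_le_sum fun B hB => ?_).trans (h1.trans ?_)
      · obtain ⟨e1, e2⟩ := hT B hB
        by_cases hq : k i < q (T B)
        · have : signedSum k a (insert i s) (T B) (q (T B)) = ε + signedSum k a s B (q (T B)) := by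
            unfold signedSum
            rw [Finset.filter_insert, if_pos hq, Finset.sum_insert (by simp [hi]), e1]
            congr 1
            refine Finset.sum_congr rfl fun j hj => ?_
            simp only [e2 j (Finset.mem_filter.1 hj).1]
          rw [this, ← add_assoc]
          gcongr
          exact le_max_left _ _
        -- Here the threshold precedes the smallest key, so the walk has not started, and c ≤ m
        -- suffices.
        · have : signedSum k a (insert i s) (T B) (q (T B)) = 0 := by
            unfold signedSum
            rw [Finset.filter_insert, if_neg hq, Finset.filter_false_of_mem, Finset.sum_empty]
            exact fun j hj => not_lt.2 ((not_lt.1 hq).trans (hmin j hj))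
          rw [this, add_zero, max_eq_left hc]
          gcongr
          exact (le_max_left _ _).trans (le_max_left _ _)
      · gcongr
    rw [Finset.sum_powerset_insert hi]
    have s1 := step (-a i) id (fun B hB => by
      have : i ∉ B := fun h => hi (Finset.mem_powerset.1 hB h)
      simp [this])
    have s2 := step (a i) (insert i) (fun B hB => by
      refine ⟨by simp, fun j hj => ?_⟩
      have : j ≠ i := fun h => hi (h ▸ hj)
      simp [this])
    refine (add_le_add s1 s2).trans (le_of_eq ?_)
    rw [Finset.sum_insert hi, Finset.card_insert_of_notMem hi]
    ring

theorem sum_sq_signedSum_le {ι : Type*} [DecidableEq ι] (k a : ι → ℝ) (s : Finset ι)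
    (q : Finset ι → ℝ) :
    ∑ B ∈ s.powerset, (signedSum k a s B (q B)) ^ 2 ≤ 2 ^ s.card * (8 * ∑ i ∈ s, a i ^ 2) := by
  have h1 := sum_sq_max_signedSum_le k a s 0 0 le_rfl le_rfl q
  have h2 := sum_sq_max_signedSum_le k (-a) s 0 0 le_rfl le_rfl q
  have hneg : ∀ B r, signedSum k (-a) s B r = -signedSum k a s B r := fun B r => by
    unfold signedSum
    rw [← Finset.sum_neg_distrib]
    refine Finset.sum_congr rfl fun j _ => ?_
    split_ifs <;> simp
  have h3 : ∀ y : ℝ, y ^ 2 ≤ (max 0 (0 + y)) ^ 2 + (max 0 (0 + -y)) ^ 2 := fun y => by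
    rcases le_total 0 y with h | h
    · rw [zero_add, max_eq_right h]; nlinarith [sq_nonneg (max 0 (0 + -y))]
    · rw [zero_add, zero_add, max_eq_right (neg_nonneg.2 h)]; nlinarith [sq_nonneg (max 0 y)]
  simp only [hneg, Pi.neg_apply, neg_sq] at h2
  calc _ ≤ ∑ B ∈ s.powerset, ((max 0 (0 + signedSum k a s B (q B))) ^ 2 +
        (max 0 (0 + -signedSum k a s B (q B))) ^ 2) := Finset.sum_le_sum fun B _ => h3 _
    _ ≤ _ := by rw [Finset.sum_add_distrib]; refine (add_le_add h1 h2).trans (le_of_eq ?_); ring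

/-- The maximal form of `sum_sq_signedSum_le`, over all rational thresholds. -/
theorem sum_iSup_sq_signedSum_le {ι : Type*} [DecidableEq ι] (k a : ι → ℝ) (s : Finset ι) :
    ∑ B ∈ s.powerset, ⨆ q : ℚ, ENNReal.ofReal ((signedSum k a s B q) ^ 2) ≤
      2 ^ s.card * ENNReal.ofReal (8 * ∑ i ∈ s, a i ^ 2) := by
  -- Only finitely many truncations occur, so the supremum is attained at a threshold depending on
  -- the signs, as the previous bound permits.
  have hex : ∀ B, ∃ q₀ : ℚ, ∀ q : ℚ, (signedSum k a s B q) ^ 2 ≤ (signedSum k a s B q₀) ^ 2 := by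
    intro B
    have hfin : (Set.range fun q : ℚ => (signedSum k a s B q) ^ 2).Finite := by
      refine ((s.powerset.finite_toSet).image
        fun U => (∑ i ∈ U, if i ∈ B then a i else -a i) ^ 2).subset ?_
      rintro _ ⟨q, rfl⟩
      exact ⟨s.filter fun i => k i < q,
        Finset.mem_coe.2 (Finset.mem_powerset.2 (Finset.filter_subset _ s)), rfl⟩
    obtain ⟨_, ⟨q₀, rfl⟩, h⟩ := Set.exists_max_image _ id hfin ⟨_, Set.mem_range_self 0⟩
    exact ⟨q₀, fun q => h _ ⟨q, rfl⟩⟩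
  choose q₀ hq₀ using hex
  calc _ ≤ ∑ B ∈ s.powerset, ENNReal.ofReal ((signedSum k a s B (q₀ B)) ^ 2) :=
        Finset.sum_le_sum fun B _ => iSup_le fun q => ENNReal.ofReal_le_ofReal (hq₀ B q)
    _ = ENNReal.ofReal (∑ B ∈ s.powerset, (signedSum k a s B (q₀ B)) ^ 2) :=
        (ENNReal.ofReal_sum_of_nonneg fun _ _ => sq_nonneg _).symm
    _ ≤ ENNReal.ofReal (2 ^ s.card * (8 * ∑ i ∈ s, a i ^ 2)) :=
        ENNReal.ofReal_le_ofReal (sum_sq_signedSum_le k a s fun B => (q₀ B : ℝ))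
    _ = _ := by
        rw [ENNReal.ofReal_mul (by positivity), ENNReal.ofReal_pow (by norm_num)]
        norm_num

/-! ### A maximal inequality for truncated empirical sums -/

section Symmetrization

variable {S : Type*} [MeasurableSpace S]

/-- The function `ψ` cut off where the coordinate `r` is at least `q`. -/
noncomputable def cutoff (r ψ : S → ℝ) (q : ℝ) (x : S) : ℝ := if r x < q then ψ x else 0

theorem measurable_cutoff {r ψ : S → ℝ} (hr : Measurable r) (hψ : Measurable ψ) (q : ℝ) :
    Measurable (cutoff r ψ q) :=
  Measurable.ite (measurableSet_lt hr measurable_const) hψ measurable_const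

theorem integrable_cutoff {Q : Measure S} {r ψ : S → ℝ} (hr : Measurable r) (hψ : Measurable ψ)
    (hint : Integrable ψ Q) (q : ℝ) : Integrable (cutoff r ψ q) Q :=
  hint.mono (measurable_cutoff hr hψ q).aestronglyMeasurable (Eventually.of_forall fun x => by
    unfold cutoff; split_ifs <;> simp)

theorem lintegral_le_rpow_lintegral_sq {α : Type*} [MeasurableSpace α] (μ : Measure α)
    [IsProbabilityMeasure μ] {f : α → ℝ≥0∞} (hf : Measurable f) :
    ∫⁻ x, f x ∂μ ≤ (∫⁻ x, f x ^ 2 ∂μ) ^ (1 / 2 : ℝ) := by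
  have h := ENNReal.lintegral_mul_le_Lp_mul_Lq μ Real.HolderConjugate.two_two hf.aemeasurable
    (aemeasurable_const (b := (1 : ℝ≥0∞)))
  simpa using h

variable (Q : Measure S) [IsProbabilityMeasure Q]

/-- Symmetrization: the mean is the expectation over an independent ghost sample, and that
expectation is pulled out of the norm and the supremum. -/
theorem lintegral_iSup_centered_le {r ψ : S → ℝ} (hr : Measurable r) (hψ : Measurable ψ)
    (hint : Integrable ψ Q) (n : ℕ) :
    ∫⁻ x, ⨆ q : ℚ, ‖∑ i, cutoff r ψ q (x i) - n * ∫ y, cutoff r ψ q y ∂Q‖ₑ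
        ∂(Measure.pi fun _ : Fin n => Q) ≤
      ∫⁻ z, ⨆ q : ℚ, ‖∑ i, (cutoff r ψ q (z i).1 - cutoff r ψ q (z i).2)‖ₑ
        ∂(Measure.pi fun _ : Fin n => Q.prod Q) := by
  have hm : ∀ q : ℚ, Measurable (cutoff r ψ q) := fun q => measurable_cutoff hr hψ q
  have hmeas : Measurable fun w : (Fin n → S) × (Fin n → S) =>
      ⨆ q : ℚ, ‖∑ i, (cutoff r ψ q (w.1 i) - cutoff r ψ q (w.2 i))‖ₑ := by
    refine Measurable.iSup fun q => Measurable.enorm ?_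
    refine Finset.measurable_sum _ fun i _ => ?_
    exact ((hm q).comp ((measurable_pi_apply i).comp measurable_fst)).sub
      ((hm q).comp ((measurable_pi_apply i).comp measurable_snd))
  have hmp := measurePreserving_arrowProdEquivProdArrow S S (Fin n) (fun _ => Q) (fun _ => Q)
  have e1 := hmp.lintegral_comp hmeas
  have e2 : ∫⁻ z, ⨆ q : ℚ, ‖∑ i, (cutoff r ψ q (z i).1 - cutoff r ψ q (z i).2)‖ₑ
        ∂(Measure.pi fun _ : Fin n => Q.prod Q) = _ := e1
  rw [e2, lintegral_prod _ hmeas.aemeasurable]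
  refine lintegral_mono fun x => iSup_le fun q => ?_
  have hi : ∀ i : Fin n, Integrable (fun y : Fin n → S => cutoff r ψ q (y i))
      (Measure.pi fun _ : Fin n => Q) := fun i =>
    (measurePreserving_eval (fun _ : Fin n => Q) i).integrable_comp_of_integrable
      (integrable_cutoff hr hψ hint q)
  have hval : ∑ i, cutoff r ψ q (x i) - n * ∫ y, cutoff r ψ q y ∂Q =
      ∫ y, ∑ i, (cutoff r ψ q (x i) - cutoff r ψ q (y i)) ∂(Measure.pi fun _ : Fin n => Q) := by
    have hi' : ∀ i ∈ (Finset.univ : Finset (Fin n)), Integrable (fun y : Fin n → S =>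
        cutoff r ψ q (x i) - cutoff r ψ q (y i)) (Measure.pi fun _ : Fin n => Q) :=
      fun i _ => (integrable_const _).sub (hi i)
    rw [integral_finsetSum _ hi']
    simp_rw [integral_sub (integrable_const _) (hi _)]
    rw [Finset.sum_sub_distrib]
    congr 1
    · simp
    · rw [Finset.sum_congr rfl fun i _ => integral_comp_eval (μ := fun _ : Fin n => Q) (i := i)
        (hm q).aestronglyMeasurable]
      simp
  rw [hval]
  refine (enorm_integral_le_lintegral_enorm _).trans (lintegral_mono fun y => ?_)
  exact le_iSup (fun q : ℚ => ‖∑ i, (cutoff r ψ q (x i) - cutoff r ψ q (y i))‖ₑ) q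

omit [MeasurableSpace S] in
-- The two samples order their keys differently, so the difference is not a single walk. It is split
-- by (u - v)² ≤ 2u² + 2v² and each half treated separately.
theorem sum_iSup_sq_signed_difference_le {r ψ : S → ℝ} {n : ℕ} (z : Fin n → S × S) :
    ∑ B : Finset (Fin n), ⨆ q : ℚ, ‖signedSum (fun i => r (z i).1) (fun i => ψ (z i).1)
        Finset.univ B q - signedSum (fun i => r (z i).2) (fun i => ψ (z i).2)
        Finset.univ B q‖ₑ ^ 2 ≤
      2 ^ n * ∑ i, (16 * ENNReal.ofReal (ψ (z i).1 ^ 2) + 16 * ENNReal.ofReal (ψ (z i).2 ^ 2)) := by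
  have hsq : ∀ u v : ℝ, ‖u - v‖ₑ ^ 2 ≤
      2 * ENNReal.ofReal (u ^ 2) + 2 * ENNReal.ofReal (v ^ 2) := by
    intro u v
    rw [Real.enorm_eq_ofReal_abs, ← ENNReal.ofReal_pow (abs_nonneg _), sq_abs,
      show (2 : ℝ≥0∞) = ENNReal.ofReal 2 by norm_num, ← ENNReal.ofReal_mul (by norm_num),
      ← ENNReal.ofReal_mul (by norm_num), ← ENNReal.ofReal_add (by positivity) (by positivity)]
    exact ENNReal.ofReal_le_ofReal (by nlinarith [sq_nonneg (u + v)])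
  have h1 := sum_iSup_sq_signedSum_le (fun i => r (z i).1) (fun i => ψ (z i).1) Finset.univ
  have h2 := sum_iSup_sq_signedSum_le (fun i => r (z i).2) (fun i => ψ (z i).2) Finset.univ
  rw [Finset.powerset_univ] at h1 h2
  have h8 : ∀ b : Fin n → ℝ, ENNReal.ofReal (8 * ∑ i, b i ^ 2) =
      8 * ∑ i, ENNReal.ofReal (b i ^ 2) := fun b => by
    rw [ENNReal.ofReal_mul (by norm_num), ENNReal.ofReal_sum_of_nonneg fun _ _ => sq_nonneg _]
    norm_num
  rw [h8, Finset.card_univ, Fintype.card_fin] at h1 h2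
  calc _ ≤ ∑ B : Finset (Fin n), (2 * (⨆ q : ℚ, ENNReal.ofReal ((signedSum (fun i => r (z i).1)
          (fun i => ψ (z i).1) Finset.univ B q) ^ 2)) +
        2 * ⨆ q : ℚ, ENNReal.ofReal ((signedSum (fun i => r (z i).2)
          (fun i => ψ (z i).2) Finset.univ B q) ^ 2)) := by
        refine Finset.sum_le_sum fun B _ => iSup_le fun q => (hsq _ _).trans ?_
        gcongr
        · exact le_iSup (fun q : ℚ => ENNReal.ofReal ((signedSum (fun i => r (z i).1)
            (fun i => ψ (z i).1) Finset.univ B q) ^ 2)) q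
        · exact le_iSup (fun q : ℚ => ENNReal.ofReal ((signedSum (fun i => r (z i).2)
            (fun i => ψ (z i).2) Finset.univ B q) ^ 2)) q
    _ ≤ 2 * (2 ^ n * (8 * ∑ i, ENNReal.ofReal (ψ (z i).1 ^ 2))) +
        2 * (2 ^ n * (8 * ∑ i, ENNReal.ofReal (ψ (z i).2 ^ 2))) := by
        rw [Finset.sum_add_distrib, ← Finset.mul_sum, ← Finset.mul_sum]
        gcongr
    _ = _ := by
        rw [Finset.sum_add_distrib, ← Finset.mul_sum, ← Finset.mul_sum]
        ring

/-- Swapping the two coordinates at any set of indices preserves the product law. Averaging over all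
2^n swaps therefore turns the differences into randomly signed sums. -/
theorem lintegral_iSup_sq_difference_le {r ψ : S → ℝ} (hr : Measurable r) (hψ : Measurable ψ)
    (n : ℕ) :
    ∫⁻ z, ⨆ q : ℚ, ‖∑ i, (cutoff r ψ q (z i).1 - cutoff r ψ q (z i).2)‖ₑ ^ 2
        ∂(Measure.pi fun _ : Fin n => Q.prod Q) ≤
      32 * n * ∫⁻ x, ENNReal.ofReal (ψ x ^ 2) ∂Q := by
  have hm : ∀ q : ℚ, Measurable (cutoff r ψ q) := fun q => measurable_cutoff hr hψ q
  set F : (Fin n → S × S) → ℝ≥0∞ := fun z =>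
    ⨆ q : ℚ, ‖∑ i, (cutoff r ψ q (z i).1 - cutoff r ψ q (z i).2)‖ₑ ^ 2 with hF
  have hFm : Measurable F := by
    refine Measurable.iSup fun q => (Measurable.enorm ?_).pow_const 2
    refine Finset.measurable_sum _ fun i _ => ?_
    exact ((hm q).comp (measurable_fst.comp (measurable_pi_apply i))).sub
      ((hm q).comp (measurable_snd.comp (measurable_pi_apply i)))
  set flip : Finset (Fin n) → (Fin n → S × S) → (Fin n → S × S) := fun B z i =>
    (if i ∈ B then id else Prod.swap) (z i) with hflip
  have hcoord : ∀ (B : Finset (Fin n)) (i : Fin n),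
      MeasurePreserving (if i ∈ B then id else Prod.swap : S × S → S × S) (Q.prod Q)
        (Q.prod Q) := by
    intro B i
    split_ifs
    · exact MeasurePreserving.id _
    · exact Measure.measurePreserving_swap
  have hmp : ∀ B, MeasurePreserving (flip B) (Measure.pi fun _ : Fin n => Q.prod Q)
      (Measure.pi fun _ : Fin n => Q.prod Q) := by
    intro B
    refine ⟨measurable_pi_lambda _ fun i =>
      (hcoord B i).measurable.comp (measurable_pi_apply i), ?_⟩
    have : ∀ i, IsProbabilityMeasure ((Q.prod Q).map
        (if i ∈ B then id else Prod.swap : S × S → S × S)) := fun i => by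
      rw [(hcoord B i).map_eq]; infer_instance
    rw [Measure.pi_map_pi (μ := fun _ : Fin n => Q.prod Q) fun i =>
      (hcoord B i).measurable.aemeasurable]
    congr 1
    funext i
    exact (hcoord B i).map_eq
  have hval : ∀ B z, F (flip B z) = ⨆ q : ℚ, ‖signedSum (fun i => r (z i).1)
        (fun i => ψ (z i).1) Finset.univ B q - signedSum (fun i => r (z i).2)
        (fun i => ψ (z i).2) Finset.univ B q‖ₑ ^ 2 := by
    intro B z
    simp only [hF, hflip, signedSum, Finset.sum_filter]
    refine iSup_congr fun q => ?_
    rw [← Finset.sum_sub_distrib]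
    congr 2
    refine Finset.sum_congr rfl fun i _ => ?_
    by_cases hi : i ∈ B <;> simp only [hi, if_true, if_false, id, cutoff, Prod.fst_swap,
      Prod.snd_swap] <;> split_ifs <;> ring
  have hsum : 2 ^ n * ∫⁻ z, F z ∂(Measure.pi fun _ : Fin n => Q.prod Q) ≤
      2 ^ n * (32 * n * ∫⁻ x, ENNReal.ofReal (ψ x ^ 2) ∂Q) := by
    calc 2 ^ n * ∫⁻ z, F z ∂(Measure.pi fun _ : Fin n => Q.prod Q)
        = ∑ B : Finset (Fin n), ∫⁻ z, F (flip B z) ∂(Measure.pi fun _ : Fin n => Q.prod Q) := by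
          rw [Finset.sum_congr rfl fun B _ => (hmp B).lintegral_comp hFm, Finset.sum_const,
            Finset.card_univ, Fintype.card_finset, Fintype.card_fin, nsmul_eq_mul]
          norm_num
      _ = ∫⁻ z, ∑ B : Finset (Fin n), F (flip B z) ∂(Measure.pi fun _ : Fin n => Q.prod Q) :=
          (lintegral_finsetSum _ fun B _ => hFm.comp (hmp B).measurable).symm
      _ ≤ ∫⁻ z, 2 ^ n * ∑ i, (16 * ENNReal.ofReal (ψ (z i).1 ^ 2) +
            16 * ENNReal.ofReal (ψ (z i).2 ^ 2)) ∂(Measure.pi fun _ : Fin n => Q.prod Q) := by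
          refine lintegral_mono fun z => ?_
          simp only [hval]
          exact sum_iSup_sq_signed_difference_le z
      _ = _ := by
          have hg : Measurable fun w : S × S => 16 * ENNReal.ofReal (ψ w.1 ^ 2) +
              16 * ENNReal.ofReal (ψ w.2 ^ 2) := by fun_prop
          rw [lintegral_const_mul _ (by fun_prop), lintegral_finsetSum _ fun i _ => by fun_prop]
          rw [Finset.sum_congr rfl fun i _ =>
            (measurePreserving_eval (fun _ : Fin n => Q.prod Q) i).lintegral_comp hg]
          rw [lintegral_add_left (by fun_prop), lintegral_const_mul _ (by fun_prop),
            lintegral_const_mul _ (by fun_prop),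
            (measurePreserving_fst (μ := Q) (ν := Q)).lintegral_comp
              (f := fun x => ENNReal.ofReal (ψ x ^ 2)) (by fun_prop),
            (measurePreserving_snd (μ := Q) (ν := Q)).lintegral_comp
              (f := fun x => ENNReal.ofReal (ψ x ^ 2)) (by fun_prop)]
          rw [Finset.sum_const, Finset.card_univ, Fintype.card_fin, nsmul_eq_mul]
          ring
  exact (ENNReal.mul_le_mul_iff_right (by positivity) (by finiteness)).1 hsum

theorem lintegral_iSup_centered_le_rpow {r ψ : S → ℝ} (hr : Measurable r) (hψ : Measurable ψ)
    (hint : Integrable ψ Q) (n : ℕ) :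
    ∫⁻ x, ⨆ q : ℚ, ‖∑ i, cutoff r ψ q (x i) - n * ∫ y, cutoff r ψ q y ∂Q‖ₑ
        ∂(Measure.pi fun _ : Fin n => Q) ≤
      (32 * n * ∫⁻ x, ENNReal.ofReal (ψ x ^ 2) ∂Q) ^ (1 / 2 : ℝ) := by
  have hm : ∀ q : ℚ, Measurable (cutoff r ψ q) := fun q => measurable_cutoff hr hψ q
  refine (lintegral_iSup_centered_le Q hr hψ hint n).trans ?_
  refine (lintegral_le_rpow_lintegral_sq _ ?_).trans ?_
  · refine Measurable.iSup fun q => Measurable.enorm ?_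
    refine Finset.measurable_sum _ fun i _ => ?_
    exact ((hm q).comp (measurable_fst.comp (measurable_pi_apply i))).sub
      ((hm q).comp (measurable_snd.comp (measurable_pi_apply i)))
  · gcongr
    refine le_trans (le_of_eq ?_) (lintegral_iSup_sq_difference_le Q hr hψ n)
    refine lintegral_congr fun z => ?_
    exact ((ENNReal.pow_right_strictMono two_ne_zero).monotone.map_iSup_of_continuousAt
      (ENNReal.continuous_pow 2).continuousAt (by simp))

end Symmetrization

/-! ### Uniform deviations over the shape class via the layer-cake formula -/

/-- Unless it is empty or has unbounded keys, a lower set for r is {r ≤ τ} or {r < τ}. Rational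
thresholds decrease to τ in the first case and increase to τ in the second. -/
theorem exists_rat_seq_eventually_lt_iff {S : Type*} {r : S → ℝ} {A : Set S}
    (hA : ∀ x y, r x ≤ r y → y ∈ A → x ∈ A) :
    ∃ u : ℕ → ℚ, ∀ x, ∀ᶠ k in atTop, (r x < u k ↔ x ∈ A) := by
  rcases A.eq_empty_or_nonempty with rfl | hne
  · refine ⟨fun k => -(k : ℚ), fun x => ?_⟩
    filter_upwards [(tendsto_natCast_atTop_atTop (R := ℝ)).eventually_ge_atTop (-r x)] with k hk
    simp only [Set.mem_empty_iff_false, iff_false, not_lt]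
    push_cast
    linarith
  by_cases hb : BddAbove (r '' A)
  · set τ := sSup (r '' A) with hτ
    have hle : ∀ x ∈ A, r x ≤ τ := fun x hx => le_csSup hb ⟨x, hx, rfl⟩
    have hlt : ∀ x, r x < τ → x ∈ A := fun x hx => by
      obtain ⟨_, ⟨y, hy, rfl⟩, hxy⟩ := exists_lt_of_lt_csSup (hne.image r) hx
      exact hA x y hxy.le hy
    by_cases hmax : ∃ y ∈ A, r y = τ
    · obtain ⟨y, hy, hyτ⟩ := hmax
      obtain ⟨u, -, hu1, hu2⟩ := Real.exists_seq_rat_strictAnti_tendsto τ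
      refine ⟨u, fun x => ?_⟩
      rcases le_or_gt (r x) τ with h | h
      · refine Eventually.of_forall fun k => iff_of_true (h.trans_lt (hu1 k)) ?_
        exact hA x y (h.trans_eq hyτ.symm) hy
      · filter_upwards [hu2.eventually_lt_const h] with k hk
        exact iff_of_false (not_lt.2 hk.le) fun hx => absurd (hle x hx) (not_le.2 h)
    · push Not at hmax
      obtain ⟨u, -, hu1, hu2⟩ := Real.exists_seq_rat_strictMono_tendsto τ
      refine ⟨u, fun x => ?_⟩
      rcases lt_or_ge (r x) τ with h | h
      · filter_upwards [hu2.eventually_const_lt h] with k hk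
        exact iff_of_true hk (hlt x h)
      · refine Eventually.of_forall fun k => iff_of_false (not_lt.2 ((hu1 k).le.trans h)) ?_
        exact fun hx => hmax x hx (le_antisymm (hle x hx) h)
  · refine ⟨fun k => k, fun x => ?_⟩
    filter_upwards [(tendsto_natCast_atTop_atTop (R := ℝ)).eventually_gt_atTop (r x)] with k hk
    refine iff_of_true (by push_cast; exact hk) ?_
    rw [not_bddAbove_iff] at hb
    obtain ⟨_, ⟨y, hy, rfl⟩, hxy⟩ := hb (r x)
    exact hA x y hxy.le hy

section LayerCake

variable {S : Type*} [MeasurableSpace S] (Q : Measure S)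

/-- Countably many thresholds keep the supremum measurable; dominated convergence shows that they
still control every lower set. -/
theorem enorm_indicator_deviation_le_iSup {r ψ : S → ℝ} (hr : Measurable r) (hψ : Measurable ψ)
    (hint : Integrable ψ Q) {A : Set S} (hA : ∀ x y, r x ≤ r y → y ∈ A → x ∈ A) {n : ℕ}
    (x : Fin n → S) :
    ‖∑ i, A.indicator ψ (x i) - n * ∫ y, A.indicator ψ y ∂Q‖ₑ ≤
      ⨆ q : ℚ, ‖∑ i, cutoff r ψ q (x i) - n * ∫ y, cutoff r ψ q y ∂Q‖ₑ := by
  obtain ⟨u, hu⟩ := exists_rat_seq_eventually_lt_iff hA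
  have hpt : ∀ y, Tendsto (fun k => cutoff r ψ (u k) y) atTop (𝓝 (A.indicator ψ y)) := by
    intro y
    refine tendsto_const_nhds.congr' ?_
    filter_upwards [hu y] with k hk
    by_cases hy : y ∈ A
    · rw [Set.indicator_of_mem hy, cutoff, if_pos (hk.2 hy)]
    · rw [Set.indicator_of_notMem hy, cutoff, if_neg fun h => hy (hk.1 h)]
  have hI : Tendsto (fun k => ∫ y, cutoff r ψ (u k) y ∂Q) atTop
      (𝓝 (∫ y, A.indicator ψ y ∂Q)) := by
    refine tendsto_integral_of_dominated_convergence (fun y => ‖ψ y‖)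
      (fun k => (measurable_cutoff hr hψ _).aestronglyMeasurable) hint.norm
      (fun k => Eventually.of_forall fun y => ?_) (Eventually.of_forall hpt)
    unfold cutoff
    split_ifs <;> simp
  have hlim := ((tendsto_finsetSum (Finset.univ : Finset (Fin n)) fun i _ => hpt (x i)).sub
    (hI.const_mul (n : ℝ))).enorm
  refine le_of_tendsto hlim (Eventually.of_forall fun k => ?_)
  exact le_iSup (fun q : ℚ => ‖∑ i, cutoff r ψ q (x i) - n * ∫ y, cutoff r ψ q y ∂Q‖ₑ) (u k)

/-- The ratio `φ / g` restricted to the superlevel set `t < (M g)^p`. -/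
noncomputable def levelRatio (φ g : S → ℝ) (M p t : ℝ) (x : S) : ℝ :=
  if t < (M * g x) ^ p then φ x / g x else 0

theorem measurable_levelRatio {φ g : S → ℝ} (hφ : Measurable φ) (hg : Measurable g) (M p : ℝ) :
    Measurable fun w : ℝ × S => levelRatio φ g M p w.1 w.2 :=
  Measurable.ite (measurableSet_lt measurable_fst (by fun_prop)) (by fun_prop) measurable_const

omit [MeasurableSpace S] in
-- On the superlevel set, M g exceeds t^(1/p), which bounds the otherwise unbounded 1/g.
theorem abs_levelRatio_le {φ g : S → ℝ} (hgpos : ∀ x, 0 < g x) {M p t : ℝ} (hM : 0 < M)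
    (hp : 0 < p) (ht : 0 < t) (x : S) :
    |levelRatio φ g M p t x| ≤ M * t ^ (-(1 / p)) * |φ x| := by
  unfold levelRatio
  split_ifs with h
  · have hMg : 0 < M * g x := mul_pos hM (hgpos x)
    have h1 : t ^ (1 / p) ≤ M * g x := by
      have := Real.rpow_le_rpow ht.le h.le (by positivity : 0 ≤ 1 / p)
      rwa [← Real.rpow_mul hMg.le, mul_one_div_cancel hp.ne', Real.rpow_one] at this
    have htp : 0 < t ^ (1 / p) := Real.rpow_pos_of_pos ht _
    rw [Real.rpow_neg ht.le, abs_div, abs_of_pos (hgpos x), div_le_iff₀ (hgpos x)]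
    have h2 : 1 ≤ M * (t ^ (1 / p))⁻¹ * g x := by
      rw [mul_right_comm, ← div_eq_mul_inv, le_div_iff₀ htp, one_mul]
      exact h1
    calc |φ x| = 1 * |φ x| := (one_mul _).symm
      _ ≤ (M * (t ^ (1 / p))⁻¹ * g x) * |φ x| := by gcongr
      _ = _ := by ring
  · rw [abs_zero]
    have := Real.rpow_nonneg ht.le (-(1 / p))
    positivity

/-- The largest deviation of a truncated sum of `levelRatio` from its mean. -/
noncomputable def levelDeviation (r φ g : S → ℝ) (M p : ℝ) {n : ℕ} (x : Fin n → S) (t : ℝ) :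
    ℝ≥0∞ :=
  ⨆ q : ℚ, ‖∑ i, cutoff r (levelRatio φ g M p t) q (x i) -
    n * ∫ y, cutoff r (levelRatio φ g M p t) q y ∂Q‖ₑ

/-- A measurable bound for the unnormalised deviations over the shape class. -/
noncomputable def shapeDeviation (r φ g : S → ℝ) (M p T : ℝ) {n : ℕ} (x : Fin n → S) : ℝ≥0∞ :=
  ∫⁻ t in Set.Ioc 0 T, levelDeviation Q r φ g M p x t

theorem measurable_levelDeviation [SFinite Q] {r φ g : S → ℝ} (hr : Measurable r)
    (hφ : Measurable φ) (hg : Measurable g) (M p : ℝ) (n : ℕ) :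
    Measurable fun w : (Fin n → S) × ℝ => levelDeviation Q r φ g M p w.1 w.2 := by
  have hc : ∀ q : ℝ, Measurable fun w : ℝ × S => cutoff r (levelRatio φ g M p w.1) q w.2 :=
    fun q => Measurable.ite (measurableSet_lt (hr.comp measurable_snd) measurable_const)
      (measurable_levelRatio hφ hg M p) measurable_const
  refine Measurable.iSup fun q => Measurable.enorm (Measurable.sub ?_ ?_)
  · refine Finset.measurable_sum _ fun i _ => ?_
    exact (hc q).comp (measurable_snd.prodMk ((measurable_pi_apply i).comp measurable_fst))
  · refine measurable_const.mul ?_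
    exact ((hc q).stronglyMeasurable.integral_prod_right'.measurable).comp measurable_snd

theorem measurable_shapeDeviation [SFinite Q] {r φ g : S → ℝ} (hr : Measurable r)
    (hφ : Measurable φ) (hg : Measurable g) (M p T : ℝ) (n : ℕ) :
    Measurable fun x : Fin n → S => shapeDeviation Q r φ g M p T x :=
  (measurable_levelDeviation Q hr hφ hg M p n).lintegral_prod_right'

variable [IsProbabilityMeasure Q]

theorem lintegral_levelDeviation_le {r φ g : S → ℝ} (hr : Measurable r) (hφ : Measurable φ)
    (hφint : Integrable φ Q) (hg : Measurable g) (hgpos : ∀ x, 0 < g x) {M p t : ℝ} (hM : 0 < M)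
    (hp : 0 < p) (ht : 0 < t) (n : ℕ) :
    ∫⁻ x, levelDeviation Q r φ g M p x t ∂(Measure.pi fun _ : Fin n => Q) ≤
      (32 * ∫⁻ x, ENNReal.ofReal (φ x ^ 2) ∂Q) ^ (1 / 2 : ℝ) * (n : ℝ≥0∞) ^ (1 / 2 : ℝ) *
        ENNReal.ofReal (M * t ^ (-(1 / p))) := by
  have hmt : Measurable (levelRatio φ g M p t) :=
    (measurable_levelRatio hφ hg M p).comp measurable_prodMk_left
  have habs := abs_levelRatio_le (φ := φ) hgpos hM hp ht
  have hu : 0 ≤ M * t ^ (-(1 / p)) := mul_nonneg hM.le (Real.rpow_nonneg ht.le _)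
  have hint : Integrable (levelRatio φ g M p t) Q :=
    (hφint.norm.const_mul (M * t ^ (-(1 / p)))).mono' hmt.aestronglyMeasurable
      (Eventually.of_forall habs)
  refine (lintegral_iSup_centered_le_rpow Q hr hmt hint n).trans ?_
  have h1 : ∫⁻ x, ENNReal.ofReal (levelRatio φ g M p t x ^ 2) ∂Q ≤
      ENNReal.ofReal (M * t ^ (-(1 / p))) ^ 2 * ∫⁻ x, ENNReal.ofReal (φ x ^ 2) ∂Q := by
    rw [← lintegral_const_mul _ (by fun_prop)]
    refine lintegral_mono fun x => ?_
    rw [← ENNReal.ofReal_pow hu, ← ENNReal.ofReal_mul (by positivity)]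
    refine ENNReal.ofReal_le_ofReal ?_
    rw [← sq_abs, ← sq_abs (φ x), ← mul_pow]
    exact pow_le_pow_left₀ (abs_nonneg _) (habs x) 2
  calc (32 * n * ∫⁻ x, ENNReal.ofReal (levelRatio φ g M p t x ^ 2) ∂Q) ^ (1 / 2 : ℝ)
      ≤ (32 * n * (ENNReal.ofReal (M * t ^ (-(1 / p))) ^ 2 *
          ∫⁻ x, ENNReal.ofReal (φ x ^ 2) ∂Q)) ^ (1 / 2 : ℝ) := by gcongr
    _ = ((32 * ∫⁻ x, ENNReal.ofReal (φ x ^ 2) ∂Q) * n *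
          ENNReal.ofReal (M * t ^ (-(1 / p))) ^ 2) ^ (1 / 2 : ℝ) := by congr 1; ring
    _ = _ := by
        rw [ENNReal.mul_rpow_of_nonneg _ _ (by norm_num), ENNReal.mul_rpow_of_nonneg _ _
          (by norm_num), ← ENNReal.rpow_natCast, ← ENNReal.rpow_mul]
        norm_num

theorem exists_lintegral_shapeDeviation_le {r φ g : S → ℝ} (hr : Measurable r) (hφ : Measurable φ)
    (hφ2 : MemLp φ 2 Q) (hg : Measurable g) (hgpos : ∀ x, 0 < g x) {M p : ℝ}
    (hM : 0 < M) (hp : 1 < p) (T : ℝ) :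
    ∃ C : ℝ≥0∞, C ≠ ⊤ ∧ ∀ n : ℕ, ∫⁻ x, shapeDeviation Q r φ g M p T x
      ∂(Measure.pi fun _ : Fin n => Q) ≤ C * (n : ℝ≥0∞) ^ (1 / 2 : ℝ) := by
  have hp0 : 0 < p := by linarith
  have hsq : ∫⁻ x, ENNReal.ofReal (φ x ^ 2) ∂Q ≠ ⊤ := by
    have := hφ2.integrable_sq.hasFiniteIntegral
    rw [hasFiniteIntegral_iff_ofReal (Eventually.of_forall fun x => sq_nonneg _)] at this
    exact this.ne
  have hD : ∫⁻ t in Set.Ioc 0 T, ENNReal.ofReal (M * t ^ (-(1 / p))) ≠ ⊤ := by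
    rcases le_or_gt T 0 with hT | hT
    · rw [Set.Ioc_eq_empty (not_lt.2 hT)]; simp
    have h1 : IntegrableOn (fun t : ℝ => M * t ^ (-(1 / p))) (Set.Ioc 0 T) := by
      -- Here p > 1, that is γ > 0, makes the singularity at t = 0 integrable.
      have : -1 < -(1 / p) := by
        rw [neg_lt_neg_iff, div_lt_one hp0]; exact hp
      exact ((intervalIntegral.intervalIntegrable_rpow' this).const_mul M).1
    have h2 : ∀ᵐ t ∂(volume.restrict (Set.Ioc 0 T)), 0 ≤ M * t ^ (-(1 / p)) := by
      filter_upwards [ae_restrict_mem measurableSet_Ioc] with t ht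
      exact mul_nonneg hM.le (Real.rpow_nonneg ht.1.le _)
    have := h1.hasFiniteIntegral
    rw [hasFiniteIntegral_iff_ofReal h2] at this
    exact this.ne
  refine ⟨(32 * ∫⁻ x, ENNReal.ofReal (φ x ^ 2) ∂Q) ^ (1 / 2 : ℝ) *
    ∫⁻ t in Set.Ioc 0 T, ENNReal.ofReal (M * t ^ (-(1 / p))), ?_, fun n => ?_⟩
  · exact ENNReal.mul_ne_top (ENNReal.rpow_ne_top_of_nonneg (by norm_num)
      (ENNReal.mul_ne_top (by norm_num) hsq)) hD
  · unfold shapeDeviation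
    rw [lintegral_lintegral_swap
      (measurable_levelDeviation Q hr hφ hg M p n).aemeasurable]
    calc _ ≤ ∫⁻ t in Set.Ioc 0 T, (32 * ∫⁻ x, ENNReal.ofReal (φ x ^ 2) ∂Q) ^ (1 / 2 : ℝ) *
          (n : ℝ≥0∞) ^ (1 / 2 : ℝ) * ENNReal.ofReal (M * t ^ (-(1 / p))) := by
          refine setLIntegral_mono' measurableSet_Ioc fun t ht => ?_
          exact lintegral_levelDeviation_le Q hr hφ (hφ2.integrable (by norm_num)) hg hgpos hM hp0
            ht.1 n
      _ = _ := by
          rw [lintegral_const_mul _ (by fun_prop)]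
          ring

theorem integral_Ioc_ite_lt (c : ℝ) {s T : ℝ} (hs : 0 ≤ s) (hsT : s ≤ T) :
    ∫ t in Set.Ioc 0 T, (if t < s then c else 0) = c * s := by
  have h1 : (fun t => if t < s then c else 0) = (Set.Iio s).indicator fun _ => c := by
    funext t; simp [Set.indicator_apply]
  rw [h1, integral_indicator measurableSet_Iio, Measure.restrict_restrict measurableSet_Iio,
    setIntegral_const]
  have h2 : Set.Iio s ∩ Set.Ioc 0 T = Set.Ioo 0 s := by
    ext t
    simp only [Set.mem_inter_iff, Set.mem_Iio, Set.mem_Ioc, Set.mem_Ioo]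
    constructor
    · rintro ⟨h1, h2, -⟩; exact ⟨h2, h1⟩
    · rintro ⟨h1, h2⟩; exact ⟨h2, h1, h2.le.trans hsT⟩
  rw [h2, Measure.real, Real.volume_Ioo, sub_zero, ENNReal.toReal_ofReal hs, smul_eq_mul, mul_comm]

/-- Layer cake and Fubini write the deviation for f as the integral over t of the deviations for {t
< f}. These are lower sets by monotonicity, so each is bounded by a supremum that no longer depends
on f. -/
theorem enorm_deviation_le_shapeDeviation {r φ g f : S → ℝ} (hr : Measurable r)
    (hφ : Measurable φ) (hφint : Integrable φ Q) (hg : Measurable g) (hgpos : ∀ x, 0 < g x)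
    {M p T B : ℝ} (hM : 0 < M) (hp : 0 < p) (hT : ∀ x, (M * g x) ^ p ≤ T)
    (hB : ∀ x, f x / g x ≤ B) (hfm : Measurable f) (hf0 : ∀ x, 0 ≤ f x)
    (hfle : ∀ x, f x ≤ (M * g x) ^ p) (hfanti : ∀ x y, r x ≤ r y → f y ≤ f x) {n : ℕ}
    (x : Fin n → S) :
    ‖∑ i, φ (x i) * (f (x i) / g (x i)) - n * ∫ y, φ y * (f y / g y) ∂Q‖ₑ ≤
      shapeDeviation Q r φ g M p T x := by
  set F : S → ℝ → ℝ := fun y t => if t < f y then φ y / g y else 0 with hF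
  have hFm : Measurable (Function.uncurry F) :=
    Measurable.ite (measurableSet_lt measurable_snd (hfm.comp measurable_fst)) (by fun_prop)
      measurable_const
  have hint1 : ∀ y, ∫ t in Set.Ioc 0 T, F y t = φ y * (f y / g y) := fun y => by
    rw [integral_Ioc_ite_lt _ (hf0 y) ((hfle y).trans (hT y))]
    ring
  have hFint : ∀ y, Integrable (F y) (volume.restrict (Set.Ioc 0 T)) := fun y => by
    refine (integrable_const |φ y / g y|).mono'
      (hFm.comp measurable_prodMk_left).aestronglyMeasurable (Eventually.of_forall fun t => ?_)
    simp only [hF]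
    split_ifs
    · exact (Real.norm_eq_abs _).le
    · rw [norm_zero]; exact abs_nonneg _
  have hprod : Integrable (Function.uncurry F) (Q.prod (volume.restrict (Set.Ioc 0 T))) := by
    rw [integrable_prod_iff hFm.aestronglyMeasurable]
    refine ⟨Eventually.of_forall hFint, ?_⟩
    have h1 : ∀ y, ∫ t in Set.Ioc 0 T, ‖Function.uncurry F (y, t)‖ = |φ y| * (f y / g y) := by
      intro y
      have : ∀ t, ‖Function.uncurry F (y, t)‖ = if t < f y then |φ y| / g y else 0 := fun t => by
        simp only [Function.uncurry, hF]
        split_ifs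
        · rw [Real.norm_eq_abs, abs_div, abs_of_pos (hgpos y)]
        · simp
      simp_rw [this]
      rw [integral_Ioc_ite_lt _ (hf0 y) ((hfle y).trans (hT y))]
      ring
    simp_rw [h1]
    refine (hφint.norm.mul_const B).mono' (by fun_prop) (Eventually.of_forall fun y => ?_)
    have : 0 ≤ f y / g y := div_nonneg (hf0 y) (hgpos y).le
    rw [Real.norm_eq_abs, abs_mul, abs_abs, abs_of_nonneg this, Real.norm_eq_abs]
    exact mul_le_mul_of_nonneg_left (hB y) (abs_nonneg _)
  have hswap : ∫ y, φ y * (f y / g y) ∂Q = ∫ t in Set.Ioc 0 T, ∫ y, F y t ∂Q := by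
    rw [← integral_integral_swap hprod]
    exact integral_congr_ae (Eventually.of_forall fun y => (hint1 y).symm)
  have hall : ∑ i, φ (x i) * (f (x i) / g (x i)) - n * ∫ y, φ y * (f y / g y) ∂Q =
      ∫ t in Set.Ioc 0 T, (∑ i, F (x i) t - n * ∫ y, F y t ∂Q) := by
    have h1 : Integrable (fun t => ∑ i, F (x i) t) (volume.restrict (Set.Ioc 0 T)) :=
      integrable_finsetSum _ fun i _ => hFint (x i)
    have h2 : Integrable (fun t => n * ∫ y, F y t ∂Q) (volume.restrict (Set.Ioc 0 T)) :=
      hprod.integral_prod_right.const_mul _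
    rw [integral_sub h1 h2, integral_finsetSum _ fun i _ => hFint (x i), integral_const_mul, hswap]
    simp_rw [hint1]
  rw [hall]
  refine (enorm_integral_le_lintegral_enorm _).trans ?_
  refine setLIntegral_mono' measurableSet_Ioc fun t ht => ?_
  have hmt : Measurable (levelRatio φ g M p t) :=
    (measurable_levelRatio hφ hg M p).comp measurable_prodMk_left
  have hint : Integrable (levelRatio φ g M p t) Q :=
    (hφint.norm.const_mul (M * t ^ (-(1 / p)))).mono' hmt.aestronglyMeasurable
      (Eventually.of_forall (abs_levelRatio_le (φ := φ) hgpos hM hp ht.1))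
  -- Since f ≤ (M g)^p, the cutoff built into `levelRatio` is inactive on {t < f}.
  have hind : ∀ y, F y t = {y | t < f y}.indicator (levelRatio φ g M p t) y := fun y => by
    simp only [hF, Set.indicator_apply, Set.mem_ofPred_eq, levelRatio]
    split_ifs with h1 h2
    · rfl
    · exact absurd (h1.trans_le (hfle y)) h2
    · rfl
  simp_rw [hind]
  exact enorm_indicator_deviation_le_iSup Q hr hmt hint
    (fun y z hyz hz => lt_of_lt_of_le hz (hfanti y z hyz)) x

end LayerCake

/-! ### Uniform law of large numbers and rate along an i.i.d. sample -/

/-- Interpolation between sample sizes: the terms after N are bounded by the envelope e alone. The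
remainder does not involve h, and it vanishes if N/n → 1 and the means of e converge. -/
theorem abs_mean_sub_le_of_le {h e : ℕ → ℝ} (hle : ∀ i, |h i| ≤ e i) {c E : ℝ} (hc : |c| ≤ E)
    {N n : ℕ} (hN : 0 < N) (hNn : N ≤ n) :
    |1 / (n : ℝ) * ∑ i ∈ Finset.range n, h i - c| ≤
      |∑ i ∈ Finset.range N, h i - N * c| / N +
        ((∑ i ∈ Finset.range n, e i) / n - N / n * ((∑ i ∈ Finset.range N, e i) / N) +
          (1 - N / n) * E) := by
  have hn : 0 < n := hN.trans_le hNn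
  have hN' : (0 : ℝ) < N := by exact_mod_cast hN
  have hn' : (0 : ℝ) < n := by exact_mod_cast hn
  have hNn' : (N : ℝ) ≤ n := by exact_mod_cast hNn
  have hsplit := fun u : ℕ → ℝ => Finset.sum_range_add_sum_Ico u hNn
  have e1 : 1 / (n : ℝ) * ∑ i ∈ Finset.range n, h i - c =
      ((∑ i ∈ Finset.range N, h i - N * c) + ∑ i ∈ Finset.Ico N n, h i +
        (-((n - N) * c))) / n := by
    rw [← hsplit h]; field_simp; ring
  have e2 : (∑ i ∈ Finset.range n, e i) / n - N / n * ((∑ i ∈ Finset.range N, e i) / N) +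
      (1 - N / n) * E = (∑ i ∈ Finset.Ico N n, e i + (n - N) * E) / n := by
    rw [← hsplit e]; field_simp; ring
  rw [e1, e2, abs_div, abs_of_pos hn']
  have h1 : |∑ i ∈ Finset.Ico N n, h i| ≤ ∑ i ∈ Finset.Ico N n, e i :=
    (Finset.abs_sum_le_sum_abs _ _).trans (Finset.sum_le_sum fun i _ => hle i)
  have h2 : |-((n - N) * c)| ≤ (n - N) * E := by
    rw [abs_neg, abs_mul, abs_of_nonneg (sub_nonneg.2 hNn')]
    exact mul_le_mul_of_nonneg_left hc (sub_nonneg.2 hNn')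
  calc _ ≤ (|∑ i ∈ Finset.range N, h i - N * c| +
        (∑ i ∈ Finset.Ico N n, e i + (n - N) * E)) / n := by
        gcongr
        refine (abs_add_three _ _ _).trans ?_
        linarith
    _ ≤ _ := by
        rw [add_div]
        gcongr

/-- The largest fourth power of an integer that is at most `n`. -/
def fourthPowerFloor (n : ℕ) : ℕ := Nat.sqrt (Nat.sqrt n) ^ 4

theorem fourthPowerFloor_le (n : ℕ) : fourthPowerFloor n ≤ n := by
  have h1 := Nat.sqrt_le' n
  have h2 := Nat.sqrt_le' (Nat.sqrt n)
  calc Nat.sqrt (Nat.sqrt n) ^ 4 = (Nat.sqrt (Nat.sqrt n) ^ 2) ^ 2 := by ring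
    _ ≤ (Nat.sqrt n) ^ 2 := Nat.pow_le_pow_left h2 2
    _ ≤ n := h1

theorem lt_sqrt_sqrt_succ_pow (n : ℕ) : n < (Nat.sqrt (Nat.sqrt n) + 1) ^ 4 := by
  have h1 := Nat.lt_succ_sqrt' n
  have h2 := Nat.lt_succ_sqrt' (Nat.sqrt n)
  calc n < (Nat.sqrt n + 1) ^ 2 := h1
    _ ≤ ((Nat.sqrt (Nat.sqrt n) + 1) ^ 2) ^ 2 := Nat.pow_le_pow_left h2 2
    _ = _ := by ring

theorem fourthPowerFloor_pos {n : ℕ} (hn : 0 < n) : 0 < fourthPowerFloor n :=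
  Nat.pow_pos (Nat.sqrt_pos.2 (Nat.sqrt_pos.2 hn))

theorem tendsto_sqrt_sqrt : Tendsto (fun n => Nat.sqrt (Nat.sqrt n)) atTop atTop := by
  refine tendsto_atTop_atTop.2 fun b => ⟨b ^ 4, fun n hn => ?_⟩
  rw [Nat.le_sqrt', Nat.le_sqrt']
  calc (b ^ 2) ^ 2 = b ^ 4 := by ring
    _ ≤ n := hn

theorem tendsto_fourthPowerFloor : Tendsto fourthPowerFloor atTop atTop :=
  tendsto_atTop_mono (fun _ => Nat.le_self_pow (by norm_num) _) tendsto_sqrt_sqrt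

theorem tendsto_fourthPowerFloor_div :
    Tendsto (fun n : ℕ => (fourthPowerFloor n : ℝ) / n) atTop (𝓝 1) := by
  have h1 : Tendsto (fun k : ℕ => ((k : ℝ) / (k + 1)) ^ 4) atTop (𝓝 1) := by
    simpa using (tendsto_natCast_div_add_atTop (1 : ℝ)).pow 4
  refine tendsto_of_tendsto_of_tendsto_of_le_of_le' (h1.comp tendsto_sqrt_sqrt)
    tendsto_const_nhds ?_ ?_
  · filter_upwards [eventually_gt_atTop 0] with n hn
    have hn' : (0 : ℝ) < n := by exact_mod_cast hn
    have h2 : (n : ℝ) ≤ ((Nat.sqrt (Nat.sqrt n) : ℝ) + 1) ^ 4 := by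
      exact_mod_cast (lt_sqrt_sqrt_succ_pow n).le
    simp only [Function.comp, fourthPowerFloor, Nat.cast_pow, div_pow]
    gcongr
  · filter_upwards [eventually_gt_atTop 0] with n hn
    rw [div_le_one (by exact_mod_cast hn)]
    exact_mod_cast fourthPowerFloor_le n

section Sample

variable {S : Type*} [MeasurableSpace S] {Ω : Type*} [MeasurableSpace Ω] {P : Measure Ω}
  {Q : Measure S} {X : ℕ → Ω → S}

theorem lintegral_sample_eq [IsProbabilityMeasure P] (hX : ∀ i, Measurable (X i)) (hlaw : ∀ i, P.map (X i) = Q)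
    (hind : iIndepFun X P) {n : ℕ} {F : (Fin n → S) → ℝ≥0∞} (hF : Measurable F) :
    ∫⁻ ω, F (fun i => X i ω) ∂P = ∫⁻ x, F x ∂(Measure.pi fun _ : Fin n => Q) := by
  have h1 : iIndepFun (fun i : Fin n => X i) P := hind.precomp Fin.val_injective
  have h2 := (iIndepFun_iff_map_fun_eq_pi_map fun i : Fin n => (hX i).aemeasurable).1 h1
  simp_rw [hlaw] at h2
  rw [← h2, lintegral_map hF (measurable_pi_lambda _ fun i => hX i)]

theorem tendsto_sample_mean (hX : ∀ i, Measurable (X i)) (hlaw : ∀ i, P.map (X i) = Q)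
    (hind : iIndepFun X P) {e : S → ℝ} (he : Measurable e) (hint : Integrable e Q) :
    ∀ᵐ ω ∂P, Tendsto (fun n : ℕ => (∑ i ∈ Finset.range n, e (X i ω)) / n) atTop
      (𝓝 (∫ y, e y ∂Q)) := by
  have h := strong_law_ae_real (μ := P) (fun i ω => e (X i ω)) (by
      rw [← hlaw 0] at hint
      exact hint.comp_measurable (hX 0))
    (fun i j hij => (hind.indepFun hij).comp he he)
    (fun i => (IdentDistrib.mk (hX i).aemeasurable (hX 0).aemeasurable
      ((hlaw i).trans (hlaw 0).symm)).comp he)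
  have h2 : ∫ ω, e (X 0 ω) ∂P = ∫ y, e y ∂Q := by
    rw [← hlaw 0, integral_map (hX 0).aemeasurable he.aestronglyMeasurable]
  rwa [h2] at h

/-- `W` serves the rate and `V` the almost sure limit. Fourth powers suit both needs of `V`: the
expectation of `W` at k⁴ is O(1/k²), hence summable, and consecutive fourth powers have ratio
tending to 1. -/
theorem exists_uniform_deviation_bounds [IsProbabilityMeasure P] (hX : ∀ i, Measurable (X i))
    (hlaw : ∀ i, P.map (X i) = Q) (hind : iIndepFun X P) {r φ g : S → ℝ} (hr : Measurable r)
    (hφ : Measurable φ) (hφ2 : MemLp φ 2 Q) (hg : Measurable g) (hgpos : ∀ x, 0 < g x)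
    {M p T B : ℝ} (hM : 0 < M) (hp : 1 < p) (hT : ∀ x, (M * g x) ^ p ≤ T)
    (hB : ∀ x, (M * g x) ^ p / g x ≤ B) :
    ∃ W V : ℕ → Ω → ℝ≥0∞, (∀ n, Measurable (W n)) ∧ (∀ n, Measurable (V n)) ∧
      (∃ C : ℝ≥0∞, C ≠ ⊤ ∧ ∀ n : ℕ, 0 < n → ∫⁻ ω, W n ω ∂P ≤ C * ENNReal.ofReal (1 / √n)) ∧
      (∀ᵐ ω ∂P, Tendsto (fun n => V n ω) atTop (𝓝 0)) ∧
      ∀ n : ℕ, 0 < n → ∀ ω, ∀ f : S → ℝ, Measurable f → (∀ x, 0 ≤ f x) →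
        (∀ x, f x ≤ (M * g x) ^ p) → (∀ x y, r x ≤ r y → f y ≤ f x) →
        ‖1 / (n : ℝ) * ∑ i : Fin n, φ (X i ω) * (f (X i ω) / g (X i ω)) -
          ∫ y, φ y * (f y / g y) ∂Q‖ₑ ≤ min (W n ω) (V n ω) := by
  have hQ : IsProbabilityMeasure Q := by
    rw [← hlaw 0]; exact Measure.isProbabilityMeasure_map (hX 0).aemeasurable
  have hφint : Integrable φ Q := hφ2.integrable (by norm_num)
  set R : ℕ → Ω → ℝ≥0∞ := fun n ω => shapeDeviation Q r φ g M p T (fun i : Fin n => X i ω) with hR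
  have hRm : ∀ n, Measurable (R n) := fun n =>
    (measurable_shapeDeviation Q hr hφ hg M p T n).comp (measurable_pi_lambda _ fun i => hX i)
  set W : ℕ → Ω → ℝ≥0∞ := fun n ω => R n ω / n with hW
  have hWm : ∀ n, Measurable (W n) := fun n => (hRm n).div_const _
  set e : S → ℝ := fun x => B * |φ x| with he
  have hem : Measurable e := by fun_prop
  have heint : Integrable e Q := hφint.norm.const_mul B
  set E := ∫ y, e y ∂Q with hE
  set m : ℕ → Ω → ℝ := fun n ω => (∑ i ∈ Finset.range n, e (X i ω)) / n with hm
  have hmm : ∀ n, Measurable (m n) := fun n =>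
    (Finset.measurable_sum _ fun i _ => hem.comp (hX i)).div_const _
  set V : ℕ → Ω → ℝ≥0∞ := fun n ω => W (fourthPowerFloor n) ω +
    ENNReal.ofReal (m n ω - (fourthPowerFloor n : ℝ) / n * m (fourthPowerFloor n) ω +
      (1 - (fourthPowerFloor n : ℝ) / n) * E) with hV
  obtain ⟨C, hC, hCle⟩ := exists_lintegral_shapeDeviation_le Q hr hφ hφ2 hg hgpos hM hp T
  have hWint : ∀ n : ℕ, 0 < n → ∫⁻ ω, W n ω ∂P ≤ C * ENNReal.ofReal (1 / √n) := by
    intro n hn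
    have hn' : (0 : ℝ) < n := by exact_mod_cast hn
    simp only [hW, div_eq_mul_inv]
    rw [lintegral_mul_const _ (hRm n), lintegral_sample_eq hX hlaw hind
      (measurable_shapeDeviation Q hr hφ hg M p T n)]
    calc _ ≤ C * (n : ℝ≥0∞) ^ (1 / 2 : ℝ) * (n : ℝ≥0∞)⁻¹ := by gcongr; exact hCle n
      _ = _ := by
        rw [mul_assoc]
        congr 1
        rw [← ENNReal.ofReal_natCast n, ENNReal.ofReal_rpow_of_pos hn',
          ← ENNReal.ofReal_inv_of_pos hn', ← ENNReal.ofReal_mul (by positivity),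
          ← Real.sqrt_eq_rpow]
        congr 1
        field_simp
        exact Real.sq_sqrt hn'.le
  refine ⟨W, V, hWm, ?_, ⟨C, hC, hWint⟩, ?_, ?_⟩
  · intro n
    exact (hWm _).add ((((hmm n).sub ((hmm _).const_mul _)).add_const _).ennreal_ofReal)
  · have hsub : ∀ᵐ ω ∂P, Tendsto (fun k : ℕ => W (k ^ 4) ω) atTop (𝓝 0) := by
      -- The shift by one avoids the empty sample, for which the bound on `W` is not available.
      have hsum : ∫⁻ ω, ∑' k : ℕ, W ((k + 1) ^ 4) ω ∂P ≠ ⊤ := by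
        rw [lintegral_tsum fun k => (hWm _).aemeasurable]
        have hs : Summable fun k : ℕ => 1 / ((k : ℝ) + 1) ^ 2 := by
          have := (summable_nat_add_iff 1).2 (Real.summable_one_div_nat_pow.2 one_lt_two)
          simpa using this
        have hle : ∀ k : ℕ, ∫⁻ ω, W ((k + 1) ^ 4) ω ∂P ≤
            C * ENNReal.ofReal (1 / ((k : ℝ) + 1) ^ 2) := fun k => by
          have h1 := hWint ((k + 1) ^ 4) (by positivity)
          have h2 : √(((k + 1) ^ 4 : ℕ) : ℝ) = ((k : ℝ) + 1) ^ 2 := by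
            push_cast
            rw [show ((k : ℝ) + 1) ^ 4 = (((k : ℝ) + 1) ^ 2) ^ 2 by ring,
              Real.sqrt_sq (by positivity)]
          rwa [h2] at h1
        refine ne_top_of_le_ne_top ?_ (ENNReal.tsum_le_tsum hle)
        rw [ENNReal.tsum_mul_left]
        exact ENNReal.mul_ne_top hC hs.tsum_ofReal_ne_top
      have hmeas : Measurable fun ω => ∑' k : ℕ, W ((k + 1) ^ 4) ω :=
        Measurable.tsum fun k => hWm _
      filter_upwards [ae_lt_top hmeas hsum] with ω hω
      exact (tendsto_add_atTop_iff_nat (f := fun k : ℕ => W (k ^ 4) ω) 1).1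
        (ENNReal.tendsto_atTop_zero_of_tsum_ne_top hω.ne)
    filter_upwards [hsub, tendsto_sample_mean hX hlaw hind hem heint] with ω h1 h2
    have h3 : Tendsto (fun n => W (fourthPowerFloor n) ω) atTop (𝓝 0) := h1.comp tendsto_sqrt_sqrt
    have h4 : Tendsto (fun n => m n ω - (fourthPowerFloor n : ℝ) / n * m (fourthPowerFloor n) ω +
        (1 - (fourthPowerFloor n : ℝ) / n) * E) atTop (𝓝 (E - 1 * E + (1 - 1) * E)) :=
      (h2.sub (tendsto_fourthPowerFloor_div.mul (h2.comp tendsto_fourthPowerFloor))).add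
        ((tendsto_const_nhds.sub tendsto_fourthPowerFloor_div).mul_const E)
    have h5 := h3.add (ENNReal.tendsto_ofReal h4)
    simpa using h5
  · intro n hn ω f hfm hf0 hfle hfanti
    set h : S → ℝ := fun y => φ y * (f y / g y) with hh
    have hdev : ∀ N : ℕ, ENNReal.ofReal (|∑ i ∈ Finset.range N, h (X i ω) - N * ∫ y, h y ∂Q|) ≤
        R N ω := fun N => by
      rw [← Real.enorm_eq_ofReal_abs, ← Fin.sum_univ_eq_sum_range (fun i => h (X i ω)) N]
      exact enorm_deviation_le_shapeDeviation Q hr hφ hφint hg hgpos hM (by linarith) hT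
        (fun x => (div_le_div_of_nonneg_right (hfle x) (hgpos x).le).trans (hB x)) hfm hf0 hfle
        hfanti _
    have hdevN : ∀ N : ℕ, 0 < N → ENNReal.ofReal
        (|∑ i ∈ Finset.range N, h (X i ω) - N * ∫ y, h y ∂Q| / N) ≤ W N ω := fun N hN => by
      rw [ENNReal.ofReal_div_of_pos (by exact_mod_cast hN), ENNReal.ofReal_natCast]
      exact ENNReal.div_le_div_right (hdev N) _
    have hhe : ∀ x, |h x| ≤ e x := fun x => by
      have h0 : 0 ≤ f x / g x := div_nonneg (hf0 x) (hgpos x).le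
      simp only [hh, he]
      rw [abs_mul, abs_of_nonneg h0, mul_comm B]
      exact mul_le_mul_of_nonneg_left
        ((div_le_div_of_nonneg_right (hfle x) (hgpos x).le).trans (hB x)) (abs_nonneg _)
    have hcE : |∫ y, h y ∂Q| ≤ E := by
      rw [← Real.norm_eq_abs]
      exact norm_integral_le_of_norm_le heint (Eventually.of_forall hhe)
    have hn' : (0 : ℝ) < n := by exact_mod_cast hn
    rw [Fin.sum_univ_eq_sum_range (fun i => h (X i ω)) n, Real.enorm_eq_ofReal_abs]
    refine le_min ?_ ?_
    · refine le_trans (le_of_eq ?_) (hdevN n hn)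
      congr 1
      rw [← abs_of_pos hn', ← abs_div, abs_of_pos hn']
      congr 1
      field_simp
    · refine (ENNReal.ofReal_le_ofReal (abs_mean_sub_le_of_le (fun i => hhe (X i ω)) hcE
        (fourthPowerFloor_pos hn) (fourthPowerFloor_le n))).trans ?_
      refine ENNReal.ofReal_add_le.trans ?_
      exact add_le_add (hdevN _ (fourthPowerFloor_pos hn)) le_rfl

end Sample

/-! ### The shape class on the half-line -/

theorem isProbabilityMeasure_densityMeasure {a : ℝ} {g : Set.Ici a → ℝ}
    (hmass : ∫⁻ x, ENNReal.ofReal (g x) ∂(halfLineVolume a) = 1) :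
    IsProbabilityMeasure (densityMeasure g) :=
  ⟨by rw [densityMeasure, withDensity_apply _ MeasurableSet.univ, Measure.restrict_univ, hmass]⟩

theorem convex_ratioClass_shapeClass {a M γ : ℝ} (g : Set.Ici a → ℝ) :
    Convex ℝ (ratioClass (shapeClass M γ g) g) := by
  rintro _ ⟨f, ⟨hf, hfa⟩, rfl⟩ _ ⟨f', ⟨hf', hfa'⟩, rfl⟩ s t hs ht hst
  refine ⟨s • f + t • f', ⟨fun x => ⟨?_, ?_⟩, ?_⟩, ?_⟩
  · have h1 := (hf x).1
    have h2 := (hf' x).1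
    simp only [Pi.add_apply, Pi.smul_apply, smul_eq_mul]
    positivity
  · calc s * f x + t * f' x ≤ s * (M * g x) ^ (1 / (1 - γ)) + t * (M * g x) ^ (1 / (1 - γ)) := by
          gcongr
          · exact (hf x).2
          · exact (hf' x).2
      _ = _ := by rw [← add_mul, hst, one_mul]
  · intro x y hxy
    have h1 := mul_le_mul_of_nonneg_left (hfa hxy) hs
    have h2 := mul_le_mul_of_nonneg_left (hfa' hxy) ht
    simp only [Pi.add_apply, Pi.smul_apply, smul_eq_mul]
    linarith
  · funext x
    simp only [Pi.add_apply, Pi.smul_apply, smul_eq_mul]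
    ring

theorem affineOn_integral {S : Type*} [MeasurableSpace S] {Q : Measure S} {l : ℕ}
    {φ : ℕ → S → ℝ} (hφ : ∀ j ≤ l, Integrable (φ j) Q) {𝓛 : Set (S → ℝ)} {B : ℝ}
    (hm : ∀ L ∈ 𝓛, Measurable L) (hB : ∀ L ∈ 𝓛, ∀ x, |L x| ≤ B) :
    AffineOn l 𝓛 (fun j L => ∫ x, φ j x * L x ∂Q) := by
  intro j hj L hL L' hL' s t _ _ _
  have hint : ∀ L ∈ 𝓛, Integrable (fun x => φ j x * L x) Q := fun L hL =>
    Integrable.mul_bdd (c := B) (hφ j hj) (hm L hL).aestronglyMeasurable (Eventually.of_forall (hB L hL))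
  simp only [Pi.add_apply, Pi.smul_apply, smul_eq_mul]
  rw [← integral_const_mul, ← integral_const_mul,
    ← integral_add ((hint L hL).const_mul s) ((hint L' hL').const_mul t)]
  congr 1
  funext x
  ring

theorem affineOn_sample_mean {S : Type*} {l n : ℕ} (φ : ℕ → S → ℝ) (𝓛 : Set (S → ℝ))
    (x : Fin n → S) :
    AffineOn l 𝓛 (fun j L => 1 / (n : ℝ) * ∑ i, φ j (x i) * L (x i)) := by
  intro j _ L _ L' _ s t _ _ _
  have h : ∑ i, φ j (x i) * (s • L + t • L') (x i) =
      s * ∑ i, φ j (x i) * L (x i) + t * ∑ i, φ j (x i) * L' (x i) := by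
    rw [Finset.mul_sum, Finset.mul_sum, ← Finset.sum_add_distrib]
    refine Finset.sum_congr rfl fun i _ => ?_
    simp only [Pi.add_apply, Pi.smul_apply, smul_eq_mul]
    ring
  simp only [h]
  ring

theorem rpow_div_le_of_antitone {a M p : ℝ} (hM : 0 < M) (hp : 1 < p) {g : Set.Ici a → ℝ}
    (hanti : Antitone g) (hpos : ∀ x, 0 < g x) (x : Set.Ici a) :
    (M * g x) ^ p / g x ≤ M ^ p * g ⟨a, Set.mem_Ici.2 le_rfl⟩ ^ (p - 1) := by
  rw [Real.mul_rpow hM.le (hpos x).le, mul_div_assoc]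
  have h1 : g x ^ p / g x = g x ^ (p - 1) := by rw [Real.rpow_sub (hpos x), Real.rpow_one]
  rw [h1]
  gcongr
  · exact (hpos x).le
  · exact hanti x.2

/-- Uniform deviation bounds for finitely many moment functions at once. -/
theorem exists_uniform_moment_bounds {a M γ : ℝ} (hM : 0 < M) (hγ : γ ∈ Set.Ioo (0 : ℝ) 1)
    {g : Set.Ici a → ℝ} (hanti : Antitone g) (hpos : ∀ x, 0 < g x)
    {l : ℕ} {φ : ℕ → Set.Ici a → ℝ} (hφ : ∀ j ≤ l, MemLp (φ j) 2 (densityMeasure g))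
    {Ω : Type*} [MeasurableSpace Ω] {P : Measure Ω} [IsProbabilityMeasure P]
    {X : ℕ → Ω → Set.Ici a} (hX : ∀ i, Measurable (X i))
    (hlaw : ∀ i, P.map (X i) = densityMeasure g) (hind : iIndepFun X P) :
    ∃ W V : ℕ → Ω → ℝ≥0∞, (∀ n, Measurable (W n)) ∧ (∀ n, Measurable (V n)) ∧
      (∃ C : ℝ≥0∞, C ≠ ⊤ ∧ ∀ n : ℕ, 0 < n → ∫⁻ ω, W n ω ∂P ≤ C * ENNReal.ofReal (1 / √n)) ∧
      (∀ᵐ ω ∂P, Tendsto (fun n => V n ω) atTop (𝓝 0)) ∧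
      ∀ᵐ ω ∂P, ∀ n : ℕ, 0 < n → ∀ j ≤ l, ∀ L ∈ ratioClass (shapeClass M γ g) g,
        ‖1 / (n : ℝ) * ∑ i : Fin n, φ j (X i ω) * L (X i ω) -
          ∫ y, φ j y * L y ∂(densityMeasure g)‖ₑ ≤ min (W n ω) (V n ω) := by
  have hγ' : 0 < 1 - γ := by linarith [hγ.2]
  have hp : 1 < 1 / (1 - γ) := by
    rw [lt_div_iff₀ hγ']; linarith [hγ.1]
  -- The moment functions are only a.e. measurable. Measurable versions have the same integrals and
  -- almost surely agree with them at all sample points, so the final bound holds for almost every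
  -- ω.
  choose! ψ hψ using fun j (hj : j ≤ l) =>
    (⟨(hφ j hj).1.mk (φ j), (hφ j hj).1.stronglyMeasurable_mk.measurable, (hφ j hj).1.ae_eq_mk⟩ :
      ∃ ψ : Set.Ici a → ℝ, Measurable ψ ∧ φ j =ᵐ[densityMeasure g] ψ)
  have hbd := fun j : Fin (l + 1) =>
    exists_uniform_deviation_bounds hX hlaw hind measurable_subtype_coe
      (hψ j (Nat.lt_succ_iff.1 j.2)).1
      ((memLp_congr_ae (hψ j (Nat.lt_succ_iff.1 j.2)).2).1 (hφ j (Nat.lt_succ_iff.1 j.2)))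
      hanti.measurable hpos hM hp
      (T := (M * g ⟨a, Set.mem_Ici.2 le_rfl⟩) ^ (1 / (1 - γ)))
      (fun x => Real.rpow_le_rpow (mul_pos hM (hpos x)).le
        (mul_le_mul_of_nonneg_left (hanti x.2) hM.le) (by positivity))
      (rpow_div_le_of_antitone hM hp hanti hpos)
  choose W V hW hV hC hlim hle using hbd
  choose C hCtop hC using hC
  refine ⟨fun n ω => ∑ j, W j n ω, fun n ω => ∑ j, V j n ω,
    fun n => Finset.measurable_sum _ fun j _ => hW j n,
    fun n => Finset.measurable_sum _ fun j _ => hV j n, ⟨∑ j, C j, ?_, ?_⟩, ?_, ?_⟩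
  · exact ENNReal.sum_ne_top.2 fun j _ => hCtop j
  · intro n hn
    rw [lintegral_finsetSum _ fun j _ => hW j n, Finset.sum_mul]
    exact Finset.sum_le_sum fun j _ => hC j n hn
  · filter_upwards [ae_all_iff.2 hlim] with ω hω
    simpa using tendsto_finsetSum (Finset.univ : Finset (Fin (l + 1))) fun j _ => hω j
  · have hae : ∀ᵐ ω ∂P, ∀ i, ∀ j : Fin (l + 1), φ j (X i ω) = ψ j (X i ω) := by
      rw [ae_all_iff]
      intro i
      rw [ae_all_iff]
      intro j
      have := (hψ j (Nat.lt_succ_iff.1 j.2)).2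
      rw [← hlaw i] at this
      exact ae_of_ae_map (hX i).aemeasurable this
    filter_upwards [hae] with ω hω n hn j hj L hL
    obtain ⟨f, ⟨hf, hfa⟩, rfl⟩ := hL
    have h1 := hle ⟨j, Nat.lt_succ_iff.2 hj⟩ n hn ω f hfa.measurable (fun x => (hf x).1)
      (fun x => (hf x).2) (fun x y hxy => hfa hxy)
    have h2 : ∫ y, φ j y * (f y / g y) ∂(densityMeasure g) =
        ∫ y, ψ j y * (f y / g y) ∂(densityMeasure g) := by
      refine integral_congr_ae ?_
      filter_upwards [(hψ j hj).2] with y hy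
      rw [hy]
    have h3 : ∑ i : Fin n, φ j (X i ω) * (f (X i ω) / g (X i ω)) =
        ∑ i : Fin n, ψ j (X i ω) * (f (X i ω) / g (X i ω)) :=
      Finset.sum_congr rfl fun i _ => by rw [hω i ⟨j, Nat.lt_succ_iff.2 hj⟩]
    simp only [h2, h3]
    refine h1.trans (min_le_min ?_ ?_)
    · exact Finset.single_le_sum (f := fun j => W j n ω) (fun _ _ => zero_le)
        (Finset.mem_univ (⟨j, Nat.lt_succ_iff.2 hj⟩ : Fin (l + 1)))
    · exact Finset.single_le_sum (f := fun j => V j n ω) (fun _ _ => zero_le)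
        (Finset.mem_univ (⟨j, Nat.lt_succ_iff.2 hj⟩ : Fin (l + 1)))

/-- If the uniform deviations of all moments are controlled, so is the deviation of the optimal
value of the sample average approximation. -/
theorem exists_saaVal_deviation_le {a M γ : ℝ} (hM : 0 < M) (hγ : γ ∈ Set.Ioo (0 : ℝ) 1)
    {g : Set.Ici a → ℝ} (hanti : Antitone g) (hpos : ∀ x, 0 < g x)
    {m l : ℕ} (hml : m ≤ l) {φ : ℕ → Set.Ici a → ℝ} {μ : ℕ → ℝ} {Q : Measure (Set.Ici a)}
    (hφ : ∀ j ≤ l, Integrable (φ j) Q)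
    (hS : SlaterCondition Q m l φ μ (ratioClass (shapeClass M γ g) g)) :
    ∃ c : ℝ, val Q m l φ μ (ratioClass (shapeClass M γ g) g) = c ∧ ∃ η > 0, ∃ K > 0,
      ∀ (n : ℕ) (x : Fin n → Set.Ici a) (Δ : ℝ), 0 ≤ Δ → Δ ≤ η →
        (∀ j ≤ l, ∀ L ∈ ratioClass (shapeClass M γ g) g,
          ‖1 / (n : ℝ) * ∑ i, φ j (x i) * L (x i) - ∫ y, φ j y * L y ∂Q‖ₑ ≤ ENNReal.ofReal Δ) →
        ∃ c' : ℝ, saaVal x m l φ μ (ratioClass (shapeClass M γ g) g) = c' ∧ |c' - c| ≤ K * Δ := by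
  have hγ' : 0 < 1 - γ := by linarith [hγ.2]
  have hp : 1 < 1 / (1 - γ) := by
    rw [lt_div_iff₀ hγ']; linarith [hγ.1]
  set B := M ^ (1 / (1 - γ)) * g ⟨a, Set.mem_Ici.2 le_rfl⟩ ^ (1 / (1 - γ) - 1) with hBdef
  have hB : ∀ L ∈ ratioClass (shapeClass M γ g) g, ∀ x, |L x| ≤ B := by
    rintro _ ⟨f, ⟨hf, -⟩, rfl⟩ x
    rw [abs_of_nonneg (div_nonneg (hf x).1 (hpos x).le)]
    exact (div_le_div_of_nonneg_right (hf x).2 (hpos x).le).trans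
      (rpow_div_le_of_antitone hM hp hanti hpos x)
  have hm : ∀ L ∈ ratioClass (shapeClass M γ g) g, Measurable L := by
    rintro _ ⟨f, ⟨-, hfa⟩, rfl⟩
    exact hfa.measurable.div hanti.measurable
  have hC : ∀ j ≤ l, ∀ L ∈ ratioClass (shapeClass M γ g) g, |∫ x, φ j x * L x ∂Q| ≤
      ∑ j ∈ Finset.range (l + 1), ∫ x, |φ j x| * B ∂Q := by
    intro j hj L hL
    have h0 : 0 ≤ B := (abs_nonneg _).trans (hB L hL ⟨a, Set.mem_Ici.2 le_rfl⟩)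
    have h1 : |∫ x, φ j x * L x ∂Q| ≤ ∫ x, |φ j x| * B ∂Q := by
      rw [← Real.norm_eq_abs]
      refine norm_integral_le_of_norm_le ((hφ j hj).abs.mul_const B)
        (Eventually.of_forall fun x => ?_)
      rw [Real.norm_eq_abs, abs_mul]
      exact mul_le_mul_of_nonneg_left (hB L hL x) (abs_nonneg _)
    refine h1.trans (Finset.single_le_sum (f := fun j => ∫ x, |φ j x| * B ∂Q) (fun i _ => ?_)
      (Finset.mem_range.2 (Nat.lt_succ_iff.2 hj)))
    exact integral_nonneg fun x => mul_nonneg (abs_nonneg _) h0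
  -- `val` and `saaVal` unfold to `momentVal` for the integral and the sample-mean functionals.
  obtain ⟨c, hc, η, hη, K, hK, h⟩ := exists_lipschitz_momentVal hml
    (convex_ratioClass_shapeClass g) (affineOn_integral hφ hm hB) hC hS
  refine ⟨c, hc, η, hη, K, hK, fun n x Δ hΔ hΔη hdev => ?_⟩
  refine h _ (affineOn_sample_mean φ _ x) Δ hΔ hΔη fun j hj L hL => ?_
  have := hdev j hj L hL
  rwa [Real.enorm_eq_ofReal_abs, ENNReal.ofReal_le_ofReal_iff hΔ] at this

end IWSAA

/-! ### Proof of the corollary -/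

open IWSAA
theorem corollary3
    -- the shape class and the sampling density
    (a M γ : ℝ) (hM : 0 < M) (hγ : γ ∈ Set.Ioo (0 : ℝ) 1)
    (g₀ : Set.Ici a → ℝ) (hg_anti : Antitone g₀) (hg_pos : ∀ x, 0 < g₀ x)
    (hg_mass : ∫⁻ x, ENNReal.ofReal (g₀ x) ∂(halfLineVolume a) = 1)
    -- the moment functions and levels
    (m l : ℕ) (hml : m ≤ l) (φ : ℕ → Set.Ici a → ℝ) (μ : ℕ → ℝ)
    (δ : ℝ) (hδ : 0 < δ)
    (hφ : ∀ j ≤ l, MemLp (φ j) (ENNReal.ofReal (2 + δ)) (densityMeasure g₀))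
    (hSlater : SlaterCondition (densityMeasure g₀) m l φ μ
      (ratioClass (shapeClass M γ g₀) g₀))
    -- the i.i.d. sample from the sampling density
    {Ω : Type*} [MeasurableSpace Ω] (P : Measure Ω) [IsProbabilityMeasure P]
    (X : ℕ → Ω → Set.Ici a) (hX_meas : ∀ i, Measurable (X i))
    (hX_law : ∀ i, P.map (X i) = densityMeasure g₀) (hX_indep : iIndepFun X P) :
    -- finite-dimensional reducibility, for every realization of the sample
    (∀ (n : ℕ) (x : Fin n → Set.Ici a),
      (fun (L : Set.Ici a → ℝ) (i : Fin n) => L (x i)) '' ratioClass (shapeClass M γ g₀) g₀ =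
          discreteShape M γ g₀ x ∧
      (fun (L : Set.Ici a → ℝ) (i : Fin n) => L (x i)) ''
          saaFeasible x m l φ μ (ratioClass (shapeClass M γ g₀) g₀) =
          lpFeasible x m l φ μ (discreteShape M γ g₀ x) ∧
      saaVal x m l φ μ (ratioClass (shapeClass M γ g₀) g₀) =
          lpVal x m l φ μ (discreteShape M γ g₀ x)) ∧
    -- consistency
    TendstoOuterAS P
      (fun n ω => saaVal (fun i : Fin n => X i ω) m l φ μ (ratioClass (shapeClass M γ g₀) g₀))
      (val (densityMeasure g₀) m l φ μ (ratioClass (shapeClass M γ g₀) g₀)) ∧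
    -- canonical convergence rate
    BoundedInOuterProb P
      (fun n ω => ((Real.sqrt n : ℝ) : EReal) *
        (saaVal (fun i : Fin n => X i ω) m l φ μ (ratioClass (shapeClass M γ g₀) g₀) -
          val (densityMeasure g₀) m l φ μ (ratioClass (shapeClass M γ g₀) g₀))) := by
  have : IsProbabilityMeasure (densityMeasure g₀) := isProbabilityMeasure_densityMeasure hg_mass
  have hφ2 : ∀ j ≤ l, MemLp (φ j) 2 (densityMeasure g₀) := fun j hj =>
    (hφ j hj).mono_exponent (by
      rw [show (2 : ℝ≥0∞) = ENNReal.ofReal 2 by norm_num]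
      exact ENNReal.ofReal_le_ofReal (by linarith))
  obtain ⟨c, hc, η, hη, K, hK, hstab⟩ := exists_saaVal_deviation_le hM hγ hg_anti hg_pos hml
    (fun j hj => (hφ2 j hj).integrable (by norm_num)) hSlater
  obtain ⟨W, V, hW, hV, ⟨C, hC, hWint⟩, hVlim, hdev⟩ :=
    exists_uniform_moment_bounds hM hγ hg_anti hg_pos hφ2 hX_meas hX_law hX_indep
  -- The free bound `U` will be `V n ω` for consistency and `W n ω` for the rate.
  have hkey : ∀ᵐ ω ∂P, ∀ n : ℕ, 0 < n → ∀ U : ℝ≥0∞, min (W n ω) (V n ω) ≤ U →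
      U ≤ ENNReal.ofReal η → ∃ c' : ℝ, saaVal (fun i : Fin n => X i ω) m l φ μ
        (ratioClass (shapeClass M γ g₀) g₀) = c' ∧ |c' - c| ≤ K * U.toReal := by
    filter_upwards [hdev] with ω hω n hn U hU hUη
    have htop : U ≠ ⊤ := ne_top_of_le_ne_top ENNReal.ofReal_ne_top hUη
    refine hstab n _ U.toReal ENNReal.toReal_nonneg (ENNReal.toReal_le_of_le_ofReal hη.le hUη) ?_
    intro j hj L hL
    rw [ENNReal.ofReal_toReal htop]
    exact (hω n hn j hj L hL).trans hU
  refine ⟨fun n x => ?_, ?_, ?_⟩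
  · have himg := image_ratioClass_eq_discreteShape hM hγ.2 hg_anti hg_pos x
    refine ⟨himg, ?_, ?_⟩
    · rw [image_saaFeasible, himg]
    · rw [saaVal_eq_lpVal, himg]
  · rw [hc]
    -- Outside the stability radius η, or for n = 0, nothing is known and the majorant is infinite;
    -- almost surely this happens only finitely often.
    refine tendstoOuterAS_of_le (V := fun n ω =>
      if V n ω ≤ ENNReal.ofReal η ∧ 0 < n then ENNReal.ofReal K * V n ω else ⊤) ?_ ?_ ?_
    · intro n
      refine Measurable.ite ?_ ((hV n).const_mul _) measurable_const
      exact (measurableSet_le (hV n) measurable_const).inter (MeasurableSet.const _)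
    · intro n
      filter_upwards [hkey] with ω hω
      split_ifs with hcase
      · obtain ⟨c', hc', hle⟩ := hω n hcase.2 (V n ω) (min_le_right _ _) hcase.1
        have htop : V n ω ≠ ⊤ := ne_top_of_le_ne_top ENNReal.ofReal_ne_top hcase.1
        rw [hc', ← EReal.coe_sub, EReal.abs_def, ← ENNReal.ofReal_toReal htop,
          ← ENNReal.ofReal_mul hK.le]
        exact ENNReal.ofReal_le_ofReal hle
      · exact le_top
    · filter_upwards [hVlim] with ω hω
      have h1 : Tendsto (fun n => ENNReal.ofReal K * V n ω) atTop (𝓝 0) := by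
        simpa using ENNReal.Tendsto.const_mul hω (Or.inr ENNReal.ofReal_ne_top)
      refine h1.congr' ?_
      filter_upwards [hω.eventually_le_const (ENNReal.ofReal_pos.2 hη), eventually_gt_atTop 0]
        with n h2 h3
      rw [if_pos ⟨h2, h3⟩]
  · rw [hc]
    intro ε hε
    -- Markov's inequality at the level K'/(K√n) gives at most C K / K', which is at most ε; the
    -- added 1 keeps K' positive.
    set K' := K * C.toReal / ε + 1 with hK'
    have hK'pos : 0 < K' := by
      have : 0 ≤ C.toReal := ENNReal.toReal_nonneg
      positivity
    refine ⟨K', hK'pos, limsup_le_of_le (by isBoundedDefault) ?_⟩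
    have hlarge : Tendsto (fun n : ℕ => √(n : ℝ)) atTop atTop :=
      Real.tendsto_sqrt_atTop.comp tendsto_natCast_atTop_atTop
    -- For such n the level K'/(K√n) is at most η, so stability applies whenever `W` is below it.
    filter_upwards [hlarge.eventually_ge_atTop (K' / (K * η)), eventually_gt_atTop 0] with n hn hn0
    have hs : 0 < √(n : ℝ) := Real.sqrt_pos.2 (by exact_mod_cast hn0)
    have ht : 0 < K' / (K * √n) := by positivity
    have htη : K' / (K * √n) ≤ η := by
      rw [div_le_iff₀ (by positivity)] at hn ⊢
      linarith
    have hsub : P {ω | ENNReal.ofReal K' ≤ (((√n : ℝ) : EReal) *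
        (saaVal (fun i : Fin n => X i ω) m l φ μ (ratioClass (shapeClass M γ g₀) g₀) - c)).abs} ≤
        P {ω | ENNReal.ofReal (K' / (K * √n)) ≤ W n ω} := by
      refine measure_mono_ae ?_
      filter_upwards [hkey] with ω hω hmem
      by_contra hlt
      have hlt' : W n ω < ENNReal.ofReal (K' / (K * √n)) := not_le.1 hlt
      obtain ⟨c', hc', hle⟩ := hω n hn0 (W n ω) (min_le_left _ _)
        (hlt'.le.trans (ENNReal.ofReal_le_ofReal htη))
      have h1 : (W n ω).toReal < K' / (K * √n) := ENNReal.toReal_lt_of_lt_ofReal hlt'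
      have hmem' : ENNReal.ofReal K' ≤ (((√n : ℝ) : EReal) *
        (saaVal (fun i : Fin n => X i ω) m l φ μ (ratioClass (shapeClass M γ g₀) g₀) - c)).abs :=
        hmem
      rw [hc', ← EReal.coe_sub, ← EReal.coe_mul, EReal.abs_def,
        ENNReal.ofReal_le_ofReal_iff (abs_nonneg _), abs_mul, abs_of_pos hs] at hmem'
      rw [lt_div_iff₀ (by positivity)] at h1
      have h2 := mul_le_mul_of_nonneg_left hle hs.le
      linarith
    refine hsub.trans ((meas_ge_le_lintegral_div (hW n).aemeasurable
      (ENNReal.ofReal_pos.2 ht).ne' ENNReal.ofReal_ne_top).trans ?_)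
    rw [ENNReal.div_le_iff (ENNReal.ofReal_pos.2 ht).ne' ENNReal.ofReal_ne_top]
    refine (hWint n hn0).trans ?_
    rw [← ENNReal.ofReal_toReal hC, ← ENNReal.ofReal_mul ENNReal.toReal_nonneg,
      ← ENNReal.ofReal_mul hε.le]
    refine ENNReal.ofReal_le_ofReal ?_
    have h3 : C.toReal * K ≤ ε * K' := by
      rw [hK', mul_add, mul_div_cancel₀ _ hε.ne']
      linarith
    rw [mul_one_div, mul_div_assoc', div_le_div_iff₀ hs (by positivity)]
    nlinarith [mul_le_mul_of_nonneg_right h3 hs.le]
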